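/- Algebras are associative complex algebras, not necessarily unital; $A\sqcup B$ denotes the free product (coproduct) of algebras, $\iota_1,\iota_2$ the embeddings of its factors, $j_1\amalg j_2 : A'\sqcup B'\to A\sqcup B$ the homomorphism induced by $j_1:A'\to A$, $j_2:B'\to B$, $A^{\sqcup m}$ the $m$-fold free product of $A$ with itself, $\mathrm T(V)=\bigoplus_{n\ge 1}V^{\otimes n}$ the non-unital tensor algebra and $\mathrm S(W)$ the (unital) symmetric algebra of a vector space. For a linear map $R:W\to C$ into a commutative unital algebra, $\mathrm S(R):\mathrm S(W)\to C$ is the unital homomorphism extending $R$. $\mathbb N=\{1,2,\dots\}$, $\mathbb N_0=\mathbb N\cup\{0\}$. Let $d,m\in\mathbb N$. A *u.a.u.-product* $\odot$ on $\mathrm{AlgP}_{d,m}$ assigns to algebras $A_1,A_2$, each equipped with an $m$-tuple of subalgebras $(A_i^{(1)},\dots,A_i^{(m)})$ which freely generates it, and to $d$-tuples $\varphi_i$ of linear functionals on $A_i$, a $d$-tuple $\varphi_1\odot\varphi_2$ of linear functionals on $A_1\sqcup A_2$ (equipped with the subalgebras $A_1^{(k)}\sqcup A_2^{(k)}$), such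 that $(\varphi_1\odot\varphi_2)\circ\iota_i=\varphi_i$ for $i=1,2$; $(\varphi_1\odot\varphi_2)\odot\varphi_3=\varphi_1\odot(\varphi_2\odot\varphi_3)$; and $(\varphi_1\odot\varphi_2)\circ(j_1\amalg j_2)=(\varphi_1\circ j_1)\odot(\varphi_2\circ j_2)$ for all algebra homomorphisms $j_1,j_2$ which map the $k$-th distinguished subalgebra into the $k$-th one for each $k$. A *dual semigroup* is an algebra $D$ with a homomorphism $\Delta:D\to D\sqcup D$ such that $(\Delta\amalg\mathrm{id})\circ\Delta=(\mathrm{id}\amalg\Delta)\circ\Delta$, $(0\amalg\mathrm{id})\circ\Delta=\iota_2$ and $(\mathrm{id}\amalg 0)\circ\Delta=\iota_1$. It is *$\mathbb N$-graded* if $D=\bigoplus_{n\ge1}D^{(n)}$ is an $\mathbb N$-graded algebra and $\Delta$ is homogeneous of degree $0$ for the induced grading of $D\sqcup D$. Let $\Delta^{\sqcup m}:D^{\sqcup m}\to D^{\sqcup m}\sqcup D^{\sqcup m}$ be the homomorphism which on the $k$-th copy of $D$ is $\Delta$ followed by the embedding of $D\sqcup D$ as the free product of the two $k$-th copies of $D$.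 **Theorem.** Let $\odot$ be a u.a.u.-product on $\mathrm{AlgP}_{d,m}$. (1) Let $D$ be an $\mathbb N$-graded dual semigroup. There is a unique linear map $\sigma:(D^{\sqcup m}\sqcup D^{\sqcup m})^d\to \mathrm S\bigl((D^{\sqcup m})^d\bigr)\otimes \mathrm S\bigl((D^{\sqcup m})^d\bigr)$ with $\varphi_1\odot\varphi_2=(\mathrm S(\varphi_1)\otimes \mathrm S(\varphi_2))\circ\sigma$ for all $d$-tuples $\varphi_1,\varphi_2$ of linear functionals on $D^{\sqcup m}$ (a $d$-tuple of functionals on $W$ being regarded as a functional on $W^d$), and $$\mathcal L_\odot(D)=\Bigl(\mathrm S\bigl((D^{\sqcup m})^d\bigr),\ \mathrm S(\sigma\circ\Delta^{\sqcup m}),\ \mathrm S(0)\Bigr)$$ is an $\mathbb N_0$-graded bialgebra for the grading induced by that of $D$ (products of homogeneous elements have the sum of the degrees of the factors as degree). (2) Let $V=\bigoplus_{n\ge1}V^{(n)}$ be an $\mathbb N$-graded vector space. Then $\mathrm T(V)$, with the comultiplication determined by $\Delta v=\iota_1 v+\iota_2 v$ for $v\in V$ and with the induced grading, is an $\mathbb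 N$-graded dual semigroup, and $\mathcal L_\odot(\mathrm T(V))$ is an $\mathbb N_0$-graded Hopf algebra (its antipode being homogeneous of degree $0$) whose component of degree $0$ is $\mathbb C\mathbf 1$. -/

import Mathlib

open scoped TensorProduct

universe u

noncomputable section

/-! ## Non-unital algebras

All algebras are associative complex algebras, in general without unit:
`[NonUnitalRing A] [Module ℂ A] [IsScalarTower ℂ A A] [SMulCommClass ℂ A A]`,
and algebra homomorphisms are `A →ₙₐ[ℂ] B`. -/

/-- A unital homomorphism from `U` to the unitization of `B` which maps the set `s` into `B`
restricts to a homomorphism from the non-unital subalgebra generated by `s` to `B`. -/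
def restrictAdjoin {U B : Type*} [Ring U] [Algebra ℂ U]
    [NonUnitalRing B] [Module ℂ B] [IsScalarTower ℂ B B] [SMulCommClass ℂ B B]
    (s : Set U) (F : U →ₐ[ℂ] Unitization ℂ B) (hF : ∀ x ∈ s, (F x).fst = 0) :
    NonUnitalAlgebra.adjoin ℂ s →ₙₐ[ℂ] B :=
  have h0 : ∀ x ∈ NonUnitalAlgebra.adjoin ℂ s, (F x).fst = 0 := fun x hx => by
    induction hx using NonUnitalAlgebra.adjoin_induction with
    | mem x hx => exact hF x hx
    | add x y _ _ hx hy => simp [hx, hy]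
    | zero => simp
    | mul x y _ _ hx hy => simp [hx, hy]
    | smul r x _ hx => simp [hx]
  { toFun := fun x => (F x.1).snd
    map_smul' := fun r x => by simp
    map_zero' := by simp
    map_add' := fun x y => by simp
    map_mul' := fun x y => by simp [h0 x.1 x.2, h0 y.1 y.2] }

/-! ### The free product of a family of algebras -/

section FreeProd

variable {I : Type} [DecidableEq I] (A : I → Type u) [∀ i, NonUnitalRing (A i)]
  [∀ i, Module ℂ (A i)] [∀ i, IsScalarTower ℂ (A i) (A i)] [∀ i, SMulCommClass ℂ (A i) (A i)]

/-- The images of the `A i` in the unital free product of the unitizations of the `A i`. -/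
def freeProdGen : Set (LinearAlgebra.FreeProduct ℂ fun i => Unitization ℂ (A i)) :=
  {x | ∃ i, ∃ a : A i,
    x = LinearAlgebra.FreeProduct.ι ℂ (fun i => Unitization ℂ (A i)) i (a : Unitization ℂ (A i))}

/-- The free product `⊔ i, A i` of (non-unital) algebras: the non-unital subalgebra generated by
the `A i` in the unital free product of their unitizations. It is the coproduct of the `A i` in
the category of algebras, see `FreeProd.lift`, `FreeProd.lift_ι` and `FreeProd.hom_ext`. -/
def FreeProd : Type u := NonUnitalAlgebra.adjoin ℂ (freeProdGen A)

namespace FreeProd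

instance : NonUnitalRing (FreeProd A) :=
  inferInstanceAs (NonUnitalRing (NonUnitalAlgebra.adjoin ℂ (freeProdGen A)))

instance : Module ℂ (FreeProd A) :=
  inferInstanceAs (Module ℂ (NonUnitalAlgebra.adjoin ℂ (freeProdGen A)))

instance : IsScalarTower ℂ (FreeProd A) (FreeProd A) :=
  inferInstanceAs (IsScalarTower ℂ (NonUnitalAlgebra.adjoin ℂ (freeProdGen A))
    (NonUnitalAlgebra.adjoin ℂ (freeProdGen A)))

instance : SMulCommClass ℂ (FreeProd A) (FreeProd A) :=
  inferInstanceAs (SMulCommClass ℂ (NonUnitalAlgebra.adjoin ℂ (freeProdGen A))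
    (NonUnitalAlgebra.adjoin ℂ (freeProdGen A)))

variable {A}

/-- The canonical homomorphism of `A i` into the free product. -/
def ι (i : I) : A i →ₙₐ[ℂ] FreeProd A :=
  NonUnitalAlgHom.codRestrict
    ((LinearAlgebra.FreeProduct.ι ℂ (fun i => Unitization ℂ (A i)) i).toNonUnitalAlgHom.comp
      (Unitization.inrNonUnitalAlgHom ℂ (A i)))
    (NonUnitalAlgebra.adjoin ℂ (freeProdGen A))
    (fun a => NonUnitalAlgebra.subset_adjoin ℂ ⟨i, a, rfl⟩)

variable {B : Type*} [NonUnitalRing B] [Module ℂ B] [IsScalarTower ℂ B B] [SMulCommClass ℂ B B]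

theorem unital_lift_ι (g : ∀ i, Unitization ℂ (A i) →ₐ[ℂ] Unitization ℂ B) (i : I)
    (a : Unitization ℂ (A i)) :
    LinearAlgebra.FreeProduct.lift ℂ (fun i => Unitization ℂ (A i)) (fun {i} => g i)
      (LinearAlgebra.FreeProduct.ι ℂ (fun i => Unitization ℂ (A i)) i a) = g i a :=
  DFunLike.congr_fun (LinearAlgebra.FreeProduct.lift_comp_ι ℂ (fun i => Unitization ℂ (A i))
    (i := i) (fun {i} => g i)) a

/-- The homomorphism `⊔ f i` on the free product given by homomorphisms `f i` on the `A i`. -/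
def lift (f : ∀ i, A i →ₙₐ[ℂ] B) : FreeProd A →ₙₐ[ℂ] B :=
  restrictAdjoin (freeProdGen A)
    (LinearAlgebra.FreeProduct.lift ℂ (fun i => Unitization ℂ (A i))
      (fun {i} => Unitization.lift ((Unitization.inrNonUnitalAlgHom ℂ B).comp (f i))))
    (by
      rintro _ ⟨i, a, rfl⟩
      rw [unital_lift_ι
        (fun i => Unitization.lift ((Unitization.inrNonUnitalAlgHom ℂ B).comp (f i)))]
      simp)

@[simp]
theorem lift_ι (f : ∀ i, A i →ₙₐ[ℂ] B) (i : I) (a : A i) : lift f (ι i a) = f i a := by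
  change (LinearAlgebra.FreeProduct.lift ℂ (fun i => Unitization ℂ (A i))
      (fun {i} => Unitization.lift ((Unitization.inrNonUnitalAlgHom ℂ B).comp (f i)))
      (LinearAlgebra.FreeProduct.ι ℂ (fun i => Unitization ℂ (A i)) i
        (a : Unitization ℂ (A i)))).snd = _
  rw [unital_lift_ι
    (fun i => Unitization.lift ((Unitization.inrNonUnitalAlgHom ℂ B).comp (f i)))]
  simp

theorem hom_ext {f g : FreeProd A →ₙₐ[ℂ] B} (h : ∀ i a, f (ι i a) = g (ι i a)) : f = g := by
  ext ⟨x, hx⟩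
  induction hx using NonUnitalAlgebra.adjoin_induction with
  | mem x hx => obtain ⟨i, a, rfl⟩ := hx; exact h i a
  | add x y hx hy h1 h2 =>
    exact (map_add f ⟨x, hx⟩ ⟨y, hy⟩).trans ((congrArg₂ _ h1 h2).trans (map_add g _ _).symm)
  | zero => exact (map_zero f).trans (map_zero g).symm
  | mul x y hx hy h1 h2 =>
    exact (map_mul f ⟨x, hx⟩ ⟨y, hy⟩).trans ((congrArg₂ _ h1 h2).trans (map_mul g _ _).symm)
  | smul r x hx h1 =>
    exact (map_smul f r ⟨x, hx⟩).trans ((congrArg _ h1).trans (map_smul g _ _).symm)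

theorem ι_injective (i : I) : Function.Injective (ι (A := A) i) := by
  have h : ∀ a : A i, lift (fun k => if e : k = i then e ▸ NonUnitalAlgHom.id ℂ (A k) else 0)
      (ι i a) = a := fun a => by simp
  exact Function.LeftInverse.injective h

end FreeProd

end FreeProd

/-! ### The free product of two algebras -/

/-- The family consisting of the two types `A` and `B`. -/
def PairFam (A B : Type u) : Bool → Type u
  | false => A
  | true => B

section Coprod

variable (A B : Type u)
  [NonUnitalRing A] [Module ℂ A] [IsScalarTower ℂ A A] [SMulCommClass ℂ A A]
  [NonUnitalRing B] [Module ℂ B] [IsScalarTower ℂ B B] [SMulCommClass ℂ B B]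

instance : ∀ i, NonUnitalRing (PairFam A B i)
  | false => inferInstanceAs (NonUnitalRing A)
  | true => inferInstanceAs (NonUnitalRing B)

instance : ∀ i, Module ℂ (PairFam A B i)
  | false => inferInstanceAs (Module ℂ A)
  | true => inferInstanceAs (Module ℂ B)

instance : ∀ i, IsScalarTower ℂ (PairFam A B i) (PairFam A B i)
  | false => inferInstanceAs (IsScalarTower ℂ A A)
  | true => inferInstanceAs (IsScalarTower ℂ B B)

instance : ∀ i, SMulCommClass ℂ (PairFam A B i) (PairFam A B i)
  | false => inferInstanceAs (SMulCommClass ℂ A A)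
  | true => inferInstanceAs (SMulCommClass ℂ B B)

/-- The free product `A ⊔ B` of two algebras. -/
def Coprod : Type u := FreeProd (PairFam A B)

namespace Coprod

instance : NonUnitalRing (Coprod A B) := inferInstanceAs (NonUnitalRing (FreeProd (PairFam A B)))

instance : Module ℂ (Coprod A B) := inferInstanceAs (Module ℂ (FreeProd (PairFam A B)))

instance : IsScalarTower ℂ (Coprod A B) (Coprod A B) :=
  inferInstanceAs (IsScalarTower ℂ (FreeProd (PairFam A B)) (FreeProd (PairFam A B)))

instance : SMulCommClass ℂ (Coprod A B) (Coprod A B) :=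
  inferInstanceAs (SMulCommClass ℂ (FreeProd (PairFam A B)) (FreeProd (PairFam A B)))

variable {A B}

/-- The embedding of the first factor. -/
def inl : A →ₙₐ[ℂ] Coprod A B := FreeProd.ι (A := PairFam A B) false

/-- The embedding of the second factor. -/
def inr : B →ₙₐ[ℂ] Coprod A B := FreeProd.ι (A := PairFam A B) true

section lift

variable {C : Type*} [NonUnitalRing C] [Module ℂ C] [IsScalarTower ℂ C C] [SMulCommClass ℂ C C]

/-- The homomorphism `f ⊔ g : A ⊔ B → C` given by `f : A → C` and `g : B → C`. -/
def lift (f : A →ₙₐ[ℂ] C) (g : B →ₙₐ[ℂ] C) : Coprod A B →ₙₐ[ℂ] C :=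
  FreeProd.lift (A := PairFam A B) fun i => match i with
    | false => f
    | true => g

@[simp]
theorem lift_inl (f : A →ₙₐ[ℂ] C) (g : B →ₙₐ[ℂ] C) (a : A) : lift f g (inl a) = f a :=
  FreeProd.lift_ι (A := PairFam A B) _ false a

@[simp]
theorem lift_inr (f : A →ₙₐ[ℂ] C) (g : B →ₙₐ[ℂ] C) (b : B) : lift f g (inr b) = g b :=
  FreeProd.lift_ι (A := PairFam A B) _ true b

theorem hom_ext {f g : Coprod A B →ₙₐ[ℂ] C} (h₁ : ∀ a, f (inl a) = g (inl a))
    (h₂ : ∀ b, f (inr b) = g (inr b)) : f = g :=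
  FreeProd.hom_ext (A := PairFam A B) fun i => match i with
    | false => h₁
    | true => h₂

end lift

section map

variable {A' B' : Type u}
  [NonUnitalRing A'] [Module ℂ A'] [IsScalarTower ℂ A' A'] [SMulCommClass ℂ A' A']
  [NonUnitalRing B'] [Module ℂ B'] [IsScalarTower ℂ B' B'] [SMulCommClass ℂ B' B']

/-- The homomorphism `j₁ ⨿ j₂ : A ⊔ B → A' ⊔ B'` given by `j₁ : A → A'` and `j₂ : B → B'`. -/
def map (j₁ : A →ₙₐ[ℂ] A') (j₂ : B →ₙₐ[ℂ] B') : Coprod A B →ₙₐ[ℂ] Coprod A' B' :=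
  lift (inl.comp j₁) (inr.comp j₂)

@[simp]
theorem map_inl (j₁ : A →ₙₐ[ℂ] A') (j₂ : B →ₙₐ[ℂ] B') (a : A) :
    map j₁ j₂ (inl a) = inl (j₁ a) := by simp [map]

@[simp]
theorem map_inr (j₁ : A →ₙₐ[ℂ] A') (j₂ : B →ₙₐ[ℂ] B') (b : B) :
    map j₁ j₂ (inr b) = inr (j₂ b) := by simp [map]

end map

/-- The natural identification `A ⊔ (B ⊔ C) → (A ⊔ B) ⊔ C`. -/
def assoc (A B C : Type u)
    [NonUnitalRing A] [Module ℂ A] [IsScalarTower ℂ A A] [SMulCommClass ℂ A A]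
    [NonUnitalRing B] [Module ℂ B] [IsScalarTower ℂ B B] [SMulCommClass ℂ B B]
    [NonUnitalRing C] [Module ℂ C] [IsScalarTower ℂ C C] [SMulCommClass ℂ C C] :
    Coprod A (Coprod B C) →ₙₐ[ℂ] Coprod (Coprod A B) C :=
  lift (inl.comp inl) (lift (inl.comp inr) inr)

end Coprod

end Coprod

/-! ## Universal products -/

/-- An algebra together with an `m`-tuple of subalgebras which freely generates it. -/
structure FacedAlg (m : ℕ) : Type (u + 1) where
  carrier : Type u
  [ring : NonUnitalRing carrier]
  [module : Module ℂ carrier]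
  [tower : IsScalarTower ℂ carrier carrier]
  [comm : SMulCommClass ℂ carrier carrier]
  face : Fin m → NonUnitalSubalgebra ℂ carrier
  freelyGenerates : Function.Bijective
    (FreeProd.lift fun k => NonUnitalSubalgebraClass.subtype (face k) :
      FreeProd (fun k => face k) →ₙₐ[ℂ] carrier)

namespace FacedAlg

instance (m : ℕ) : CoeSort (FacedAlg.{u} m) (Type u) := ⟨FacedAlg.carrier⟩

attribute [instance] FacedAlg.ring FacedAlg.module FacedAlg.tower FacedAlg.comm

variable {m : ℕ}

/-- Homomorphisms which respect the faces. -/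
def RespectsFaces (A B : FacedAlg.{u} m) (j : A →ₙₐ[ℂ] B) : Prop :=
  ∀ k, ∀ a ∈ A.face k, j a ∈ B.face k

/-- Two homomorphisms on a faced algebra agree if they agree on the faces. -/
theorem hom_ext (A : FacedAlg.{u} m) {C : Type*} [NonUnitalRing C] [Module ℂ C]
    [IsScalarTower ℂ C C] [SMulCommClass ℂ C C] {f g : A →ₙₐ[ℂ] C}
    (h : ∀ k, ∀ a ∈ A.face k, f a = g a) : f = g := by
  ext a
  obtain ⟨x, rfl⟩ := A.freelyGenerates.2 a
  have : f.comp (FreeProd.lift fun k => NonUnitalSubalgebraClass.subtype (A.face k)) =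
      g.comp (FreeProd.lift fun k => NonUnitalSubalgebraClass.subtype (A.face k)) :=
    FreeProd.hom_ext fun k a => by simpa using h k a a.2
  exact DFunLike.congr_fun this x

/-- Homomorphisms on the faces extend to a homomorphism on the whole algebra. -/
theorem exists_lift (A : FacedAlg.{u} m) {C : Type*} [NonUnitalRing C] [Module ℂ C]
    [IsScalarTower ℂ C C] [SMulCommClass ℂ C C] (f : ∀ k, A.face k →ₙₐ[ℂ] C) :
    ∃ F : A →ₙₐ[ℂ] C, ∀ k (a : A.face k), F a = f k a := by
  let p : FreeProd (fun k => A.face k) →ₙₐ[ℂ] A :=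
    FreeProd.lift fun k => NonUnitalSubalgebraClass.subtype (A.face k)
  let e := Equiv.ofBijective p A.freelyGenerates
  have he : ∀ x, p (e.symm x) = x := e.apply_symm_apply
  have hp : Function.Injective p := A.freelyGenerates.1
  let q : A →ₙₐ[ℂ] FreeProd (fun k => A.face k) :=
    { toFun := e.symm
      map_smul' := fun r x => hp (by rw [he]; simp [he])
      map_zero' := hp (by rw [he]; simp)
      map_add' := fun x y => hp (by rw [he]; simp [he])
      map_mul' := fun x y => hp (by rw [he]; simp [he]) }
  refine ⟨(FreeProd.lift f).comp q, fun k a => ?_⟩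
  have : q a = FreeProd.ι (A := fun k => A.face k) k a := hp (by
    change p (e.symm a) = _
    rw [he]; simp [p])
  simp [this]

/-- A criterion for free generation. -/
theorem bijective_of {C : Type u} [NonUnitalRing C] [Module ℂ C]
    [IsScalarTower ℂ C C] [SMulCommClass ℂ C C] (F : Fin m → NonUnitalSubalgebra ℂ C)
    (q : C →ₙₐ[ℂ] FreeProd (fun k => F k))
    (h₁ : ∀ k (a : F k), q a = FreeProd.ι (A := fun k => F k) k a)
    (h₂ : (FreeProd.lift fun k => NonUnitalSubalgebraClass.subtype (F k)).comp q =
      NonUnitalAlgHom.id ℂ C) :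
    Function.Bijective (FreeProd.lift fun k => NonUnitalSubalgebraClass.subtype (F k) :
      FreeProd (fun k => F k) →ₙₐ[ℂ] C) := by
  have h₃ : q.comp (FreeProd.lift fun k => NonUnitalSubalgebraClass.subtype (F k)) =
      NonUnitalAlgHom.id ℂ _ := FreeProd.hom_ext fun k a => by simpa using h₁ k a
  exact ⟨Function.LeftInverse.injective (DFunLike.congr_fun h₃),
    Function.RightInverse.surjective (DFunLike.congr_fun h₂)⟩

/-- The `k`-th face of `A ⊔ B` is the subalgebra generated by the `k`-th faces of `A` and `B`. -/
def prodFace (A B : FacedAlg.{u} m) (k : Fin m) : NonUnitalSubalgebra ℂ (Coprod A B) :=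
  NonUnitalAlgebra.adjoin ℂ
    (((Coprod.inl : A →ₙₐ[ℂ] Coprod A B) '' (A.face k : Set A)) ∪
      ((Coprod.inr : B →ₙₐ[ℂ] Coprod A B) '' (B.face k : Set B)))

/-- `A ⊔ B` with the faces `A⁽ᵏ⁾ ⊔ B⁽ᵏ⁾`. -/
def prod (A B : FacedAlg.{u} m) : FacedAlg.{u} m where
  carrier := Coprod A B
  face := prodFace A B
  freelyGenerates := by
    have hl : ∀ k (a : A.face k), Coprod.inl (a : A) ∈ prodFace A B k := fun k a =>
      NonUnitalAlgebra.subset_adjoin ℂ (Or.inl ⟨a, a.2, rfl⟩)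
    have hr : ∀ k (b : B.face k), Coprod.inr (b : B) ∈ prodFace A B k := fun k b =>
      NonUnitalAlgebra.subset_adjoin ℂ (Or.inr ⟨b, b.2, rfl⟩)
    obtain ⟨f, hf⟩ := A.exists_lift fun k =>
      (FreeProd.ι (A := fun k => prodFace A B k) k).comp
        (NonUnitalAlgHom.codRestrict
          ((Coprod.inl : A →ₙₐ[ℂ] Coprod A B).comp
            (NonUnitalSubalgebraClass.subtype (A.face k))) (prodFace A B k) (hl k))
    obtain ⟨g, hg⟩ := B.exists_lift fun k =>
      (FreeProd.ι (A := fun k => prodFace A B k) k).comp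
        (NonUnitalAlgHom.codRestrict
          ((Coprod.inr : B →ₙₐ[ℂ] Coprod A B).comp
            (NonUnitalSubalgebraClass.subtype (B.face k))) (prodFace A B k) (hr k))
    refine bijective_of _ (Coprod.lift f g) ?_ ?_
    · rintro k ⟨x, hx⟩
      induction hx using NonUnitalAlgebra.adjoin_induction with
      | mem x hx =>
        rcases hx with ⟨a, ha, rfl⟩ | ⟨b, hb, rfl⟩
        · exact (Coprod.lift_inl f g a).trans (hf k ⟨a, ha⟩)
        · exact (Coprod.lift_inr f g b).trans (hg k ⟨b, hb⟩)
      | add x y hx hy h1 h2 =>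
        have := map_add (FreeProd.ι (A := fun k => prodFace A B k) k) ⟨x, hx⟩ ⟨y, hy⟩
        rw [← h1, ← h2] at this
        exact (map_add (Coprod.lift f g) x y).trans this.symm
      | zero =>
        exact (map_zero (Coprod.lift f g)).trans
          (map_zero (FreeProd.ι (A := fun k => prodFace A B k) k)).symm
      | mul x y hx hy h1 h2 =>
        have := map_mul (FreeProd.ι (A := fun k => prodFace A B k) k) ⟨x, hx⟩ ⟨y, hy⟩
        rw [← h1, ← h2] at this
        exact (map_mul (Coprod.lift f g) x y).trans this.symm
      | smul r x hx h1 =>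
        have := map_smul (FreeProd.ι (A := fun k => prodFace A B k) k) r ⟨x, hx⟩
        rw [← h1] at this
        exact (map_smul (Coprod.lift f g) r x).trans this.symm
    · refine Coprod.hom_ext (fun a => ?_) (fun b => ?_)
      · have : ((FreeProd.lift fun k => NonUnitalSubalgebraClass.subtype (prodFace A B k)).comp
            f) = Coprod.inl := A.hom_ext fun k a ha => by
          exact (congrArg (FreeProd.lift fun k =>
            NonUnitalSubalgebraClass.subtype (prodFace A B k)) (hf k ⟨a, ha⟩)).trans
            (FreeProd.lift_ι _ k _)
        simpa using DFunLike.congr_fun this a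
      · have : ((FreeProd.lift fun k => NonUnitalSubalgebraClass.subtype (prodFace A B k)).comp
            g) = Coprod.inr := B.hom_ext fun k b hb => by
          exact (congrArg (FreeProd.lift fun k =>
            NonUnitalSubalgebraClass.subtype (prodFace A B k)) (hg k ⟨b, hb⟩)).trans
            (FreeProd.lift_ι _ k _)
        simpa using DFunLike.congr_fun this b

/-- The `m`-fold free product `D^{⊔ m}` of an algebra with itself; its faces are the `m` copies
of `D`. -/
def power (m : ℕ) (D : Type u) [NonUnitalRing D] [Module ℂ D] [IsScalarTower ℂ D D]
    [SMulCommClass ℂ D D] : FacedAlg.{u} m where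
  carrier := FreeProd fun _ : Fin m => D
  face k := NonUnitalAlgHom.range (FreeProd.ι (A := fun _ : Fin m => D) k)
  freelyGenerates := by
    refine bijective_of _ (FreeProd.lift fun k =>
      (FreeProd.ι (A := fun k =>
        NonUnitalAlgHom.range (FreeProd.ι (A := fun _ : Fin m => D) k)) k).comp
        (NonUnitalAlgHom.codRestrict (FreeProd.ι (A := fun _ : Fin m => D) k) _
          fun a => ⟨a, rfl⟩)) ?_ ?_
    · rintro k ⟨_, a, rfl⟩
      exact FreeProd.lift_ι (A := fun _ : Fin m => D) _ k a
    · refine FreeProd.hom_ext fun k a => ?_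
      simp only [NonUnitalAlgHom.comp_apply, FreeProd.lift_ι]
      rfl

end FacedAlg

/-- `d`-tuples of linear functionals. -/
abbrev DualTuple (d : ℕ) (W : Type*) [AddCommGroup W] [Module ℂ W] : Type _ :=
  Fin d → (W →ₗ[ℂ] ℂ)

/-- The `d`-tuple `φ ∘ j`. -/
def DualTuple.comp {d : ℕ} {A B : Type*} [NonUnitalRing A] [Module ℂ A]
    [NonUnitalRing B] [Module ℂ B] (φ : DualTuple d A) (j : B →ₙₐ[ℂ] A) : DualTuple d B :=
  fun l => φ l ∘ₗ (j : B →ₗ[ℂ] A)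

/-- A `d`-tuple of linear functionals on `W` as one linear functional on `W^d`. -/
def DualTuple.total {d : ℕ} {W : Type*} [AddCommGroup W] [Module ℂ W] (φ : DualTuple d W) :
    (Fin d → W) →ₗ[ℂ] ℂ :=
  ∑ l, φ l ∘ₗ LinearMap.proj l

/-- Unital associative universal products on the category of algebras with `m` freely generating
subalgebras and `d` linear functionals. -/
structure UAUProduct (d m : ℕ) : Type (u + 1) where
  /-- the `d`-tuple `φ₁ ⊙ φ₂` on `A ⊔ B` -/
  prod : ∀ (A B : FacedAlg.{u} m), DualTuple d A → DualTuple d B → DualTuple d (A.prod B)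
  unital_left : ∀ (A B : FacedAlg.{u} m) (φ₁ : DualTuple d A) (φ₂ : DualTuple d B),
    (prod A B φ₁ φ₂).comp (Coprod.inl : A →ₙₐ[ℂ] Coprod A B) = φ₁
  unital_right : ∀ (A B : FacedAlg.{u} m) (φ₁ : DualTuple d A) (φ₂ : DualTuple d B),
    (prod A B φ₁ φ₂).comp (Coprod.inr : B →ₙₐ[ℂ] Coprod A B) = φ₂
  associative : ∀ (A B C : FacedAlg.{u} m)
    (φ₁ : DualTuple d A) (φ₂ : DualTuple d B) (φ₃ : DualTuple d C),
    (prod (A.prod B) C (prod A B φ₁ φ₂) φ₃).comp (Coprod.assoc A B C) =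
      prod A (B.prod C) φ₁ (prod B C φ₂ φ₃)
  universal : ∀ (A B A' B' : FacedAlg.{u} m) (j₁ : A' →ₙₐ[ℂ] A) (j₂ : B' →ₙₐ[ℂ] B),
    FacedAlg.RespectsFaces A' A j₁ → FacedAlg.RespectsFaces B' B j₂ →
    ∀ (φ₁ : DualTuple d A) (φ₂ : DualTuple d B),
      (prod A B φ₁ φ₂).comp (Coprod.map j₁ j₂) = prod A' B' (φ₁.comp j₁) (φ₂.comp j₂)

/-! ## Dual semigroups -/

/-- The structure of a dual semigroup on an algebra `D`; the counit is `0 : D → {0}`. -/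
structure DualSemigroup (D : Type u) [NonUnitalRing D] [Module ℂ D] [IsScalarTower ℂ D D]
    [SMulCommClass ℂ D D] where
  Δ : D →ₙₐ[ℂ] Coprod D D
  coassoc : (Coprod.map Δ (NonUnitalAlgHom.id ℂ D)).comp Δ =
    (Coprod.assoc D D D).comp ((Coprod.map (NonUnitalAlgHom.id ℂ D) Δ).comp Δ)
  counit_left : (Coprod.map (0 : D →ₙₐ[ℂ] D) (NonUnitalAlgHom.id ℂ D)).comp Δ = Coprod.inr
  counit_right : (Coprod.map (NonUnitalAlgHom.id ℂ D) (0 : D →ₙₐ[ℂ] D)).comp Δ = Coprod.inl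

section Grading

variable {A : Type*} [NonUnitalRing A] [Module ℂ A]

/-- `ProductOfDegree G n a`: the element `a` is a product of elements of the sets `G i`, and the
degrees `i` of the factors add up to `n`. -/
inductive ProductOfDegree (G : ℕ+ → Set A) : ℕ+ → A → Prop
  | of {n : ℕ+} {a : A} : a ∈ G n → ProductOfDegree G n a
  | mul {n k : ℕ+} {a b : A} : ProductOfDegree G n a → ProductOfDegree G k b →
      ProductOfDegree G (n + k) (a * b)

/-- The linear span of the products of total degree `n`. -/
def generatedGrading (G : ℕ+ → Set A) (n : ℕ+) : Submodule ℂ A :=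
  Submodule.span ℂ {a | ProductOfDegree G n a}

/-- `ℕ`-graded algebras, `ℕ = {1, 2, …}`. -/
structure IsGradedAlg (𝒜 : ℕ+ → Submodule ℂ A) : Prop where
  isInternal : DirectSum.IsInternal 𝒜
  mul_mem : ∀ {n k : ℕ+} {a b : A}, a ∈ 𝒜 n → b ∈ 𝒜 k → a * b ∈ 𝒜 (n + k)

end Grading

section Graded

variable {D : Type u} [NonUnitalRing D] [Module ℂ D] [IsScalarTower ℂ D D] [SMulCommClass ℂ D D]

/-- The grading of `D ⊔ D` induced by a grading of `D`. -/
def coprodGrading (𝒟 : ℕ+ → Submodule ℂ D) : ℕ+ → Submodule ℂ (Coprod D D) :=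
  generatedGrading fun n => (Coprod.inl : D →ₙₐ[ℂ] Coprod D D) '' (𝒟 n : Set D) ∪
    (Coprod.inr : D →ₙₐ[ℂ] Coprod D D) '' (𝒟 n : Set D)

/-- The grading of `D^{⊔ m}` induced by a grading of `D`. -/
def powerGrading (m : ℕ) (𝒟 : ℕ+ → Submodule ℂ D) : ℕ+ → Submodule ℂ (FacedAlg.power m D) :=
  generatedGrading (A := FreeProd fun _ : Fin m => D) fun n =>
    {x | ∃ k, ∃ a ∈ 𝒟 n, x = FreeProd.ι (A := fun _ : Fin m => D) k a}

/-- `ℕ`-graded dual semigroups: `D` is a graded algebra and `Δ` is homogeneous of degree `0`. -/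
structure DualSemigroup.IsGraded (S : DualSemigroup D) (𝒟 : ℕ+ → Submodule ℂ D) : Prop where
  isGradedAlg : IsGradedAlg 𝒟
  comul_mem : ∀ n, ∀ a ∈ 𝒟 n, S.Δ a ∈ coprodGrading 𝒟 n

/-- The comultiplication `Δ^{⊔ m} : D^{⊔ m} → D^{⊔ m} ⊔ D^{⊔ m}`; on the `k`-th copy of `D` it is
`Δ`, followed by the embedding of `D ⊔ D` into the `k`-th face of `D^{⊔ m} ⊔ D^{⊔ m}`. -/
def DualSemigroup.powerΔ (S : DualSemigroup D) (m : ℕ) :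
    FacedAlg.power m D →ₙₐ[ℂ] (FacedAlg.power m D).prod (FacedAlg.power m D) :=
  FreeProd.lift (A := fun _ : Fin m => D)
    (B := Coprod (FreeProd fun _ : Fin m => D) (FreeProd fun _ : Fin m => D)) fun k =>
    (Coprod.map (FreeProd.ι (A := fun _ : Fin m => D) k)
      (FreeProd.ι (A := fun _ : Fin m => D) k)).comp S.Δ

end Graded

/-! ## The bialgebra of a dual semigroup and a universal product -/

/-- The grading of the symmetric algebra `S(W)` induced by an `ℕ`-grading of `W`: a product
`w₁ ⋯ wᵣ`, `r ≥ 0`, of homogeneous elements of `W` has degree `deg w₁ + ⋯ + deg wᵣ`. -/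
def symGrading {W : Type*} [AddCommGroup W] [Module ℂ W] (𝒲 : ℕ+ → Submodule ℂ W) (n : ℕ) :
    Submodule ℂ (SymmetricAlgebra ℂ W) :=
  Submodule.span ℂ {x | ∃ (r : ℕ) (deg : Fin r → ℕ+) (w : Fin r → W),
    (∀ i, w i ∈ 𝒲 (deg i)) ∧ ∑ i, (deg i : ℕ) = n ∧ x = ∏ i, SymmetricAlgebra.ι ℂ W (w i)}

namespace UAUProduct

variable {d m : ℕ} (P : UAUProduct.{u} d m)

/-- `σ` is a linear map `(A ⊔ B)^d → S(A^d) ⊗ S(B^d)` with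
`φ₁ ⊙ φ₂ = (S(φ₁) ⊗ S(φ₂)) ∘ σ` for all `φ₁`, `φ₂`. -/
def IsSigma (A B : FacedAlg.{u} m) (σ : (Fin d → A.prod B) →ₗ[ℂ]
    SymmetricAlgebra ℂ (Fin d → A) ⊗[ℂ] SymmetricAlgebra ℂ (Fin d → B)) : Prop :=
  ∀ (φ₁ : DualTuple d A) (φ₂ : DualTuple d B) (x : Fin d → A.prod B),
    (P.prod A B φ₁ φ₂).total x =
      Algebra.TensorProduct.lmul' ℂ (Algebra.TensorProduct.map
        (SymmetricAlgebra.lift φ₁.total) (SymmetricAlgebra.lift φ₂.total) (σ x))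

open Classical in
/-- A map `σ` with `φ₁ ⊙ φ₂ = (S(φ₁) ⊗ S(φ₂)) ∘ σ` for all `φ₁`, `φ₂`, and `0` if there is none. -/
def sigma (A B : FacedAlg.{u} m) : (Fin d → A.prod B) →ₗ[ℂ]
    SymmetricAlgebra ℂ (Fin d → A) ⊗[ℂ] SymmetricAlgebra ℂ (Fin d → B) :=
  if h : ∃ σ, P.IsSigma A B σ then h.choose else 0

end UAUProduct

section Lachs

variable (d m : ℕ) (D : Type u) [NonUnitalRing D] [Module ℂ D] [IsScalarTower ℂ D D]
  [SMulCommClass ℂ D D]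

/-- The algebra `S((D^{⊔ m})^d)`. -/
abbrev LachsAlg : Type u := SymmetricAlgebra ℂ (Fin d → FacedAlg.power m D)

/-- The counit `S(0)`. -/
def lachsCounit : LachsAlg d m D →ₐ[ℂ] ℂ := SymmetricAlgebra.lift 0

variable {d m D}

/-- The comultiplication `S(σ ∘ Δ^{⊔ m})`. -/
def lachsComul (P : UAUProduct.{u} d m) (S : DualSemigroup D) :
    LachsAlg d m D →ₐ[ℂ] LachsAlg d m D ⊗[ℂ] LachsAlg d m D :=
  SymmetricAlgebra.lift (P.sigma (FacedAlg.power m D) (FacedAlg.power m D) ∘ₗ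
    (S.powerΔ m : FacedAlg.power m D →ₗ[ℂ]
      (FacedAlg.power m D).prod (FacedAlg.power m D)).compLeft (Fin d))

/-- The `ℕ₀`-grading of `S((D^{⊔ m})^d)` induced by an `ℕ`-grading of `D`. -/
def lachsGrading (d m : ℕ) (𝒟 : ℕ+ → Submodule ℂ D) : ℕ → Submodule ℂ (LachsAlg d m D) :=
  symGrading fun n => Submodule.pi Set.univ fun _ : Fin d => powerGrading m 𝒟 n

end Lachs

/-! ## Graded bialgebras and Hopf algebras -/

section Bialgebra

variable {B : Type*} [CommRing B] [Algebra ℂ B]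

/-- The algebra `B` is a bialgebra with comultiplication `Δ` and counit `ε`. -/
structure IsBialgebra (Δ : B →ₐ[ℂ] B ⊗[ℂ] B) (ε : B →ₐ[ℂ] ℂ) : Prop where
  coassoc : (Algebra.TensorProduct.assoc ℂ ℂ ℂ B B B).toAlgHom.comp
      ((Algebra.TensorProduct.map Δ (AlgHom.id ℂ B)).comp Δ) =
    (Algebra.TensorProduct.map (AlgHom.id ℂ B) Δ).comp Δ
  counit_left : (Algebra.TensorProduct.lid ℂ B).toAlgHom.comp
      ((Algebra.TensorProduct.map ε (AlgHom.id ℂ B)).comp Δ) = AlgHom.id ℂ B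
  counit_right : (Algebra.TensorProduct.rid ℂ ℂ B).toAlgHom.comp
      ((Algebra.TensorProduct.map (AlgHom.id ℂ B) ε).comp Δ) = AlgHom.id ℂ B

/-- The subspace `⊕_{k + l = n} B⁽ᵏ⁾ ⊗ B⁽ˡ⁾` of `B ⊗ B`. -/
def tensorDegree (ℬ : ℕ → Submodule ℂ B) (n : ℕ) : Submodule ℂ (B ⊗[ℂ] B) :=
  ⨆ p ∈ Finset.HasAntidiagonal.antidiagonal n,
    LinearMap.range (TensorProduct.map (ℬ p.1).subtype (ℬ p.2).subtype)

/-- `ℕ₀`-graded bialgebras. -/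
structure IsGradedBialgebra (ℬ : ℕ → Submodule ℂ B) (Δ : B →ₐ[ℂ] B ⊗[ℂ] B) (ε : B →ₐ[ℂ] ℂ) :
    Prop where
  isBialgebra : IsBialgebra Δ ε
  isInternal : DirectSum.IsInternal ℬ
  gradedMonoid : SetLike.GradedMonoid ℬ
  comul_mem : ∀ n, ∀ b ∈ ℬ n, Δ b ∈ tensorDegree ℬ n
  counit_eq_zero : ∀ n, n ≠ 0 → ∀ b ∈ ℬ n, ε b = 0

/-- `ℕ₀`-graded Hopf algebras: there is an antipode, and it is homogeneous of degree `0`. -/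
structure IsGradedHopfAlgebra (ℬ : ℕ → Submodule ℂ B) (Δ : B →ₐ[ℂ] B ⊗[ℂ] B) (ε : B →ₐ[ℂ] ℂ) :
    Prop where
  isGradedBialgebra : IsGradedBialgebra ℬ Δ ε
  exists_antipode : ∃ α : B →ₗ[ℂ] B,
    LinearMap.mul' ℂ B ∘ₗ α.rTensor B ∘ₗ Δ.toLinearMap =
      Algebra.linearMap ℂ B ∘ₗ ε.toLinearMap ∧
    LinearMap.mul' ℂ B ∘ₗ α.lTensor B ∘ₗ Δ.toLinearMap =
      Algebra.linearMap ℂ B ∘ₗ ε.toLinearMap ∧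
    ∀ n, ∀ b ∈ ℬ n, α b ∈ ℬ n

end Bialgebra

/-! ## The dual semigroup `T(V)` -/

section Tensor

variable (V : Type u) [AddCommGroup V] [Module ℂ V]

/-- The non-unital tensor algebra `T(V) = ⊕_{n ≥ 1} V^{⊗ n}`: the non-unital subalgebra
generated by `V` in the unital tensor algebra. -/
def NTensor : Type u :=
  NonUnitalAlgebra.adjoin ℂ (Set.range (TensorAlgebra.ι ℂ : V →ₗ[ℂ] TensorAlgebra ℂ V))

namespace NTensor

instance : NonUnitalRing (NTensor V) := inferInstanceAs (NonUnitalRing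
  (NonUnitalAlgebra.adjoin ℂ (Set.range (TensorAlgebra.ι ℂ : V →ₗ[ℂ] TensorAlgebra ℂ V))))

instance : Module ℂ (NTensor V) := inferInstanceAs (Module ℂ
  (NonUnitalAlgebra.adjoin ℂ (Set.range (TensorAlgebra.ι ℂ : V →ₗ[ℂ] TensorAlgebra ℂ V))))

instance : IsScalarTower ℂ (NTensor V) (NTensor V) := inferInstanceAs (IsScalarTower ℂ
  (NonUnitalAlgebra.adjoin ℂ (Set.range (TensorAlgebra.ι ℂ : V →ₗ[ℂ] TensorAlgebra ℂ V)))
  (NonUnitalAlgebra.adjoin ℂ (Set.range (TensorAlgebra.ι ℂ : V →ₗ[ℂ] TensorAlgebra ℂ V))))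

instance : SMulCommClass ℂ (NTensor V) (NTensor V) := inferInstanceAs (SMulCommClass ℂ
  (NonUnitalAlgebra.adjoin ℂ (Set.range (TensorAlgebra.ι ℂ : V →ₗ[ℂ] TensorAlgebra ℂ V)))
  (NonUnitalAlgebra.adjoin ℂ (Set.range (TensorAlgebra.ι ℂ : V →ₗ[ℂ] TensorAlgebra ℂ V))))

variable {V}

/-- The embedding of `V` into `T(V)`. -/
def ι : V →ₗ[ℂ] NTensor V where
  toFun v := ⟨TensorAlgebra.ι ℂ v, NonUnitalAlgebra.subset_adjoin ℂ ⟨v, rfl⟩⟩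
  map_add' v w := Subtype.ext (map_add (TensorAlgebra.ι ℂ) v w)
  map_smul' r v := Subtype.ext (map_smul (TensorAlgebra.ι ℂ) r v)

variable {B : Type*} [NonUnitalRing B] [Module ℂ B] [IsScalarTower ℂ B B] [SMulCommClass ℂ B B]

/-- The homomorphism `T(R) : T(V) → B` given by a linear map `R : V → B`. -/
def lift (R : V →ₗ[ℂ] B) : NTensor V →ₙₐ[ℂ] B :=
  restrictAdjoin (Set.range (TensorAlgebra.ι ℂ : V →ₗ[ℂ] TensorAlgebra ℂ V))
    (TensorAlgebra.lift ℂ ((Unitization.inrNonUnitalAlgHom ℂ B : B →ₗ[ℂ] Unitization ℂ B) ∘ₗ R))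
    (by rintro _ ⟨v, rfl⟩; simp)

@[simp]
theorem lift_ι (R : V →ₗ[ℂ] B) (v : V) : lift R (ι v) = R v := by
  change (TensorAlgebra.lift ℂ
    ((Unitization.inrNonUnitalAlgHom ℂ B : B →ₗ[ℂ] Unitization ℂ B) ∘ₗ R)
    (TensorAlgebra.ι ℂ v)).snd = _
  simp

theorem hom_ext {f g : NTensor V →ₙₐ[ℂ] B} (h : ∀ v, f (ι v) = g (ι v)) : f = g := by
  ext ⟨x, hx⟩
  induction hx using NonUnitalAlgebra.adjoin_induction with
  | mem x hx => obtain ⟨v, rfl⟩ := hx; exact h v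
  | add x y hx hy h1 h2 =>
    exact (map_add f ⟨x, hx⟩ ⟨y, hy⟩).trans ((congrArg₂ _ h1 h2).trans (map_add g _ _).symm)
  | zero => exact (map_zero f).trans (map_zero g).symm
  | mul x y hx hy h1 h2 =>
    exact (map_mul f ⟨x, hx⟩ ⟨y, hy⟩).trans ((congrArg₂ _ h1 h2).trans (map_mul g _ _).symm)
  | smul r x hx h1 =>
    exact (map_smul f r ⟨x, hx⟩).trans ((congrArg _ h1).trans (map_smul g _ _).symm)

/-- The grading of `T(V)` induced by an `ℕ`-grading of `V`. -/
def grading (𝒱 : ℕ+ → Submodule ℂ V) : ℕ+ → Submodule ℂ (NTensor V) :=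
  generatedGrading fun n => ι '' (𝒱 n : Set V)

variable (V)

/-- The comultiplication of `T(V)`, with `Δ v = ι₁ v + ι₂ v` for `v ∈ V`. -/
def comul : NTensor V →ₙₐ[ℂ] Coprod (NTensor V) (NTensor V) :=
  lift (((Coprod.inl : NTensor V →ₙₐ[ℂ] Coprod (NTensor V) (NTensor V)) :
      NTensor V →ₗ[ℂ] Coprod (NTensor V) (NTensor V)) ∘ₗ ι +
    ((Coprod.inr : NTensor V →ₙₐ[ℂ] Coprod (NTensor V) (NTensor V)) :
      NTensor V →ₗ[ℂ] Coprod (NTensor V) (NTensor V)) ∘ₗ ι)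

@[simp]
theorem comul_ι (v : V) : comul V (ι v) = Coprod.inl (ι v) + Coprod.inr (ι v) := by
  simp [comul]

/-- The dual semigroup `T(V)`. -/
def dualSemigroup : DualSemigroup (NTensor V) where
  Δ := comul V
  coassoc := hom_ext fun v => by simp [Coprod.assoc, add_assoc]
  counit_left := hom_ext fun v => by simp
  counit_right := hom_ext fun v => by simp

end NTensor

end Tensor

end

/-!
Universality carries the value of `φ₁ ⊙ φ₂` on a word to a free algebra on coloured letters, and
therefore makes it a function `F` of the moments of `φ₁` and `φ₂` along words in these letters;
identifying letters, one may assume that each of them occurs exactly once. Scaling a letter `i` by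
`r` multiplies `F` by `r` and a moment by the power of `r` counting the occurrences of `i`. The
substitution `i ↦ γ i + δ ∗` with a new letter `∗` realizes three prescribed families of moments by
one pair of functionals, so that `F` is additive in the moments which are linear in `i`. It follows
that `F` depends only on the finitely many moments without repeated letters and is affine in each of
them, hence is a polynomial. These polynomials are the values of `σ`.

The characters `S(φ)` separate the points of the symmetric algebra over an infinite field, and
`S(σ ∘ Δ)` is dual to their convolution `(φ₁ ⊙ φ₂) ∘ Δ`, so that the laws of a bialgebra become
those of a monoid for the convolution, which follow from those of `⊙` and `Δ`. All the gradings are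
eigenspace decompositions of the maps which multiply by `2 ^ n` in degree `n`; by universality the
one on `D` commutes with all the structure. In the connected case the identity is inverted for the
convolution product by its Neumann series, which is finite in each degree.
-/

noncomputable section

/-! ## Generation -/

theorem FreeProd.eq_top_of_ι_mem {I : Type} [DecidableEq I] {A : I → Type u}
    [∀ i, NonUnitalRing (A i)] [∀ i, Module ℂ (A i)] [∀ i, IsScalarTower ℂ (A i) (A i)]
    [∀ i, SMulCommClass ℂ (A i) (A i)] {N : NonUnitalSubalgebra ℂ (FreeProd A)}
    (h : ∀ i a, FreeProd.ι i a ∈ N) : N = ⊤ := by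
  rw [eq_top_iff]
  rintro ⟨x, hx⟩ -
  induction hx using NonUnitalAlgebra.adjoin_induction with
  | mem x hx => obtain ⟨i, a, rfl⟩ := hx; exact h i a
  | add x y _ _ hxN hyN => exact N.add_mem hxN hyN
  | zero => exact N.zero_mem
  | mul x y _ _ hxN hyN => exact N.mul_mem hxN hyN
  | smul r x _ hxN => exact N.smul_mem r hxN

theorem Coprod.eq_top_of_mem {A B : Type u}
    [NonUnitalRing A] [Module ℂ A] [IsScalarTower ℂ A A] [SMulCommClass ℂ A A]
    [NonUnitalRing B] [Module ℂ B] [IsScalarTower ℂ B B] [SMulCommClass ℂ B B]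
    {N : NonUnitalSubalgebra ℂ (Coprod A B)} (h₁ : ∀ a, Coprod.inl a ∈ N)
    (h₂ : ∀ b, Coprod.inr b ∈ N) : N = ⊤ :=
  FreeProd.eq_top_of_ι_mem (A := PairFam A B) (N := N) fun i => match i with
    | false => h₁
    | true => h₂

theorem FacedAlg.eq_top_of_face_le {m : ℕ} (A : FacedAlg.{u} m) {N : NonUnitalSubalgebra ℂ A}
    (h : ∀ k, A.face k ≤ N) : N = ⊤ := by
  refine eq_top_iff.2 fun x _ => ?_
  obtain ⟨y, rfl⟩ := A.freelyGenerates.2 x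
  have hN : N.comap (FreeProd.lift fun k => NonUnitalSubalgebraClass.subtype (A.face k)) = ⊤ :=
    FreeProd.eq_top_of_ι_mem fun k a => by
      rw [NonUnitalSubalgebra.mem_comap, FreeProd.lift_ι]
      exact h k a.2
  exact (hN.ge NonUnitalAlgebra.mem_top : y ∈ N.comap _)

/-! ## Words -/

/-- The number of occurrences of the letter `x` in the word `w`. -/
def letterCount {X : Type*} [DecidableEq X] (x : X) (w : FreeSemigroup X) : ℕ :=
  (w.head :: w.tail).count x

section letterCount

variable {X : Type*} [DecidableEq X]

@[simp]
theorem letterCount_mul (x : X) (v w : FreeSemigroup X) :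
    letterCount x (v * w) = letterCount x v + letterCount x w := by
  simp only [letterCount, FreeSemigroup.head_mul, FreeSemigroup.tail_mul]
  rw [← List.count_append, List.cons_append]

theorem letterCount_of (x y : X) :
    letterCount x (FreeSemigroup.of y) = if y = x then 1 else 0 := by
  simp [letterCount, FreeSemigroup.of, List.count_singleton]

theorem letterCount_head_pos (w : FreeSemigroup X) : 0 < letterCount w.head w := by
  simp [letterCount]

theorem finite_setOf_letterCount_le_one [Finite X] :
    {w : FreeSemigroup X | ∀ x, letterCount x w ≤ 1}.Finite := by
  have := Fintype.ofFinite X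
  have hnodup : {l : List X | l.Nodup}.Finite :=
    (List.finite_length_le X (Fintype.card X)).subset fun l hl => hl.length_le_card
  have hinj : Function.Injective fun w : FreeSemigroup X => w.head :: w.tail := by
    rintro ⟨a, l⟩ ⟨b, k⟩ h
    simpa using h
  exact (hnodup.preimage hinj.injOn).subset fun w hw => List.nodup_iff_count_le_one.2 hw

theorem letterCount_map_of_injective {Y : Type*} [DecidableEq Y] {f : X → Y}
    (hf : Function.Injective f) (x : X) (w : FreeSemigroup X) :
    letterCount (f x) (FreeSemigroup.map f w) = letterCount x w := by
  induction w using FreeSemigroup.recOnMul with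
  | ih1 y => simp [letterCount_of, hf.eq_iff]
  | ih2 y w hy hw => rw [map_mul, letterCount_mul, hy, hw, letterCount_mul]

theorem letterCount_map_of_notMem_range {Y : Type*} {f : Y → X} {x : X} (hx : x ∉ Set.range f)
    (w : FreeSemigroup Y) : letterCount x (FreeSemigroup.map f w) = 0 := by
  induction w using FreeSemigroup.recOnMul with
  | ih1 y => simpa [letterCount_of] using fun h => hx ⟨y, h⟩
  | ih2 y w hy hw => rw [map_mul, letterCount_mul, hy, hw]

theorem lift_congr_of_letterCount_eq_zero {C : Type*} [Semigroup C] {g g' : X → C} {x : X}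
    (h : ∀ y, y ≠ x → g y = g' y) {w : FreeSemigroup X} (hw : letterCount x w = 0) :
    FreeSemigroup.lift g w = FreeSemigroup.lift g' w := by
  induction w using FreeSemigroup.recOnMul with
  | ih1 y => simpa using h y fun hy => by simp [letterCount_of, hy] at hw
  | ih2 y w ihy ihw =>
    rw [letterCount_mul, Nat.add_eq_zero_iff] at hw
    rw [map_mul, map_mul, ihy hw.1, ihw hw.2]

variable {R C : Type*} [CommSemiring R] [NonUnitalSemiring C] [Module R C] [IsScalarTower R C C]
  [SMulCommClass R C C]

theorem lift_update_smul (g : X → C) (x : X) (r : R) (w : FreeSemigroup X) :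
    FreeSemigroup.lift (Function.update g x (r • g x)) w =
      r ^ letterCount x w • FreeSemigroup.lift g w := by
  induction w using FreeSemigroup.recOnMul with
  | ih1 y => rcases eq_or_ne y x with rfl | hy <;> simp [letterCount_of, *]
  | ih2 y w hy hw => rw [map_mul, hy, hw, map_mul, letterCount_mul, smul_mul_smul_comm, pow_add]

theorem exists_linearMap_lift_update_eq (R : Type*) [CommSemiring R] [Module R C]
    [IsScalarTower R C C] [SMulCommClass R C C] (g : X → C) {x : X} {w : FreeSemigroup X}
    (hw : letterCount x w = 1) :
    ∃ L : C →ₗ[R] C, ∀ a, FreeSemigroup.lift (Function.update g x a) w = L a := by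
  have lift_update_of_letterCount_eq_zero {w} (hw : letterCount x w = 0) (a : C) :
      FreeSemigroup.lift (Function.update g x a) w = FreeSemigroup.lift g w :=
    lift_congr_of_letterCount_eq_zero (fun y hy => Function.update_of_ne hy a g) hw
  induction w using FreeSemigroup.recOnMul with
  | ih1 y =>
    obtain rfl : y = x := by simpa [letterCount_of] using hw
    exact ⟨LinearMap.id, fun a => by simp⟩
  | ih2 y w ihy ihw =>
    rw [letterCount_mul, Nat.add_eq_one_iff] at hw
    rcases hw with ⟨hy, hw⟩ | ⟨hy, hw⟩
    · obtain ⟨L, hL⟩ := ihw hw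
      refine ⟨LinearMap.mulLeft R (FreeSemigroup.lift g (FreeSemigroup.of y)) ∘ₗ L, fun a => ?_⟩
      rw [map_mul, hL, lift_update_of_letterCount_eq_zero hy]
      rfl
    · obtain ⟨L, hL⟩ := ihy hy
      refine ⟨LinearMap.mulRight R (FreeSemigroup.lift g w) ∘ₗ L, fun a => ?_⟩
      rw [map_mul, hL, lift_update_of_letterCount_eq_zero hw]
      rfl

end letterCount

theorem map_freeSemigroup_lift {X M N F : Type*} [Semigroup M] [Semigroup N] [FunLike F M N]
    [MulHomClass F M N] (f : F) (g : X → M) (w : FreeSemigroup X) :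
    f (FreeSemigroup.lift g w) = FreeSemigroup.lift (f ∘ g) w :=
  DFunLike.congr_fun (FreeSemigroup.hom_ext rfl :
    (f : M →ₙ* N).comp (FreeSemigroup.lift g) = FreeSemigroup.lift (f ∘ g)) w

theorem freeSemigroup_lift_map {X Y M : Type*} [Semigroup M] (g : Y → M) (f : X → Y)
    (w : FreeSemigroup X) :
    FreeSemigroup.lift g (FreeSemigroup.map f w) = FreeSemigroup.lift (g ∘ f) w :=
  map_freeSemigroup_lift _ _ w

theorem exists_multilinear_word {Y : Type u} (w : FreeSemigroup Y) :
    ∃ (X : Type u) (_ : Finite X) (_ : DecidableEq X) (g : X → Y) (v : FreeSemigroup X),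
      (∀ x, letterCount x v = 1) ∧ FreeSemigroup.map g v = w := by
  induction w using FreeSemigroup.recOnMul with
  | ih1 y =>
    exact ⟨PUnit, inferInstance, inferInstance, fun _ => y, FreeSemigroup.of PUnit.unit,
      fun x => by simp [letterCount_of], rfl⟩
  | ih2 y w _ ihw =>
    obtain ⟨X₁, _, _, g₁, v₁, hv₁, rfl⟩ := ihw
    refine ⟨Option X₁, inferInstance, inferInstance, fun o => o.elim y g₁,
      FreeSemigroup.of none * FreeSemigroup.map some v₁, ?_, ?_⟩
    · rintro (_ | x)
      · simp [letterCount_of, letterCount_map_of_notMem_range]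
      · simp [letterCount_of, letterCount_map_of_injective (Option.some_injective _), hv₁]
    · rw [map_mul, FreeSemigroup.map_of]
      exact congrArg (FreeSemigroup.of y * ·) (freeSemigroup_lift_map _ _ _)

/-! ## Free algebras on coloured letters -/

/-- The free (non-unital) algebra on a set `X` of letters. -/
abbrev WordAlg (X : Type*) : Type _ := MonoidAlgebra ℂ (FreeSemigroup X)

namespace WordAlg

variable {X : Type*}

/-- A word as an element of the free algebra. -/
def word (w : FreeSemigroup X) : WordAlg X := MonoidAlgebra.single w 1

theorem word_mul (v w : FreeSemigroup X) : word (v * w) = word v * word w := by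
  simp [word, MonoidAlgebra.single_mul_single]

/-- A letter as an element of the free algebra. -/
def letter (x : X) : WordAlg X := word (FreeSemigroup.of x)

theorem lift_letter_eq_word (w : FreeSemigroup X) : FreeSemigroup.lift letter w = word w := by
  induction w using FreeSemigroup.recOnMul with
  | ih1 x => rfl
  | ih2 x w hx hw => rw [map_mul, hx, hw, word_mul]

section lift

variable {A : Type*} [NonUnitalRing A] [Module ℂ A]

theorem hom_ext {f g : WordAlg X →ₙₐ[ℂ] A} (h : ∀ x, f (letter x) = g (letter x)) : f = g := by
  refine MonoidAlgebra.nonUnitalAlgHom_ext ℂ fun w => ?_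
  change f (word w) = g (word w)
  rw [← lift_letter_eq_word, map_freeSemigroup_lift, map_freeSemigroup_lift]
  exact congrArg (fun k => FreeSemigroup.lift k w) (funext h)

variable [IsScalarTower ℂ A A] [SMulCommClass ℂ A A]

/-- The homomorphism on the free algebra with prescribed values on the letters. -/
def lift (a : X → A) : WordAlg X →ₙₐ[ℂ] A := MonoidAlgebra.liftMagma ℂ (FreeSemigroup.lift a)

@[simp]
theorem lift_word (a : X → A) (w : FreeSemigroup X) :
    lift a (word w) = FreeSemigroup.lift a w := by
  simp [lift, word]

@[simp]
theorem lift_letter (a : X → A) (x : X) : lift a (letter x) = a x := by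
  simp [letter]

end lift

/-- The linear functional on the free algebra with prescribed values on the words. -/
def functional (u : FreeSemigroup X → ℂ) : WordAlg X →ₗ[ℂ] ℂ :=
  (MonoidAlgebra.basis (FreeSemigroup X) ℂ).constr ℂ u

theorem basis_apply (w : FreeSemigroup X) :
    MonoidAlgebra.basis (FreeSemigroup X) ℂ w = word w := by
  simp [word]

@[simp]
theorem functional_word (u : FreeSemigroup X → ℂ) (w : FreeSemigroup X) :
    functional u (word w) = u w := by
  rw [← basis_apply, functional, Module.Basis.constr_basis]

theorem functional_apply_word (f : WordAlg X →ₗ[ℂ] ℂ) :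
    functional (fun w => f (word w)) = f :=
  (MonoidAlgebra.basis (FreeSemigroup X) ℂ).ext fun w => by
    rw [basis_apply, functional_word]

variable {m : ℕ}

/-- The subalgebra generated by the letters of colour `k`. -/
def face (c : X → Fin m) (k : Fin m) : NonUnitalSubalgebra ℂ (WordAlg X) :=
  NonUnitalAlgebra.adjoin ℂ (letter '' (c ⁻¹' {k}))

theorem letter_mem_face (c : X → Fin m) (x : X) : letter x ∈ face c (c x) :=
  NonUnitalAlgebra.subset_adjoin ℂ ⟨x, rfl, rfl⟩

theorem face_le_comap_lift {A : Type*} [NonUnitalRing A] [Module ℂ A] [IsScalarTower ℂ A A]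
    [SMulCommClass ℂ A A] {c : X → Fin m} {F : Fin m → NonUnitalSubalgebra ℂ A} {a : X → A}
    (ha : ∀ x, a x ∈ F (c x)) (k : Fin m) : face c k ≤ (F k).comap (lift a) := by
  refine NonUnitalAlgebra.adjoin_le ?_
  rintro _ ⟨x, rfl, rfl⟩
  simpa using ha x

/-- The homomorphism from the free algebra to the free product of its faces which sends a letter
to itself, regarded as an element of the face of its colour. -/
def toFreeProd (c : X → Fin m) : WordAlg X →ₙₐ[ℂ] FreeProd fun k => face c k :=
  lift fun x => FreeProd.ι (A := fun k => face c k) (c x) ⟨letter x, letter_mem_face c x⟩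

theorem toFreeProd_eq_ι (c : X → Fin m) {k : Fin m} (z : face c k) :
    toFreeProd c z = FreeProd.ι (A := fun k => face c k) k z := by
  obtain ⟨z, hz⟩ := z
  let ι := FreeProd.ι (A := fun k => face c k) k
  induction hz using NonUnitalAlgebra.adjoin_induction with
  | mem z hz => obtain ⟨x, rfl, rfl⟩ := hz; exact lift_letter _ x
  | add x y hx hy ihx ihy =>
    exact ((map_add _ x y).trans (congrArg₂ _ ihx ihy)).trans (map_add ι ⟨x, hx⟩ ⟨y, hy⟩).symm
  | zero => exact (map_zero _).trans (map_zero ι).symm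
  | mul x y hx hy ihx ihy =>
    exact ((map_mul _ x y).trans (congrArg₂ _ ihx ihy)).trans (map_mul ι ⟨x, hx⟩ ⟨y, hy⟩).symm
  | smul r x hx ihx =>
    exact ((map_smul _ r x).trans (congrArg _ ihx)).trans (map_smul ι r ⟨x, hx⟩).symm

end WordAlg

/-- The free algebra on a set of coloured letters; its faces are the subalgebras generated by the
letters of one colour. -/
def FacedAlg.ofColours {m : ℕ} {X : Type u} (c : X → Fin m) : FacedAlg.{u} m where
  carrier := WordAlg X
  face := WordAlg.face c
  freelyGenerates := by
    refine bijective_of _ (WordAlg.toFreeProd c) (fun k z => WordAlg.toFreeProd_eq_ι c z) ?_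
    refine WordAlg.hom_ext fun x => ?_
    simp only [WordAlg.toFreeProd, NonUnitalAlgHom.comp_apply, WordAlg.lift_letter,
      FreeProd.lift_ι]
    rfl

/-! ## Universal products along words -/

section tagged

variable {X : Type*} {A B : Type u}
  [NonUnitalRing A] [Module ℂ A] [IsScalarTower ℂ A A] [SMulCommClass ℂ A A]
  [NonUnitalRing B] [Module ℂ B] [IsScalarTower ℂ B B] [SMulCommClass ℂ B B]

/-- The letters of a word evaluated in a free product `A ⊔ B`: the tag `t x` says whether the letter
`x` stands for the element `a x` of the first factor (`false`) or for the element `b x` of the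
second one (`true`). -/
def tagged (t : X → Bool) (a : X → A) (b : X → B) (x : X) : Coprod A B :=
  if t x then Coprod.inr (b x) else Coprod.inl (a x)

theorem map_comp_tagged {A' B' : Type u}
    [NonUnitalRing A'] [Module ℂ A'] [IsScalarTower ℂ A' A'] [SMulCommClass ℂ A' A']
    [NonUnitalRing B'] [Module ℂ B'] [IsScalarTower ℂ B' B'] [SMulCommClass ℂ B' B']
    (f : A →ₙₐ[ℂ] A') (g : B →ₙₐ[ℂ] B') (t : X → Bool) (a : X → A) (b : X → B) :
    Coprod.map f g ∘ tagged t a b = tagged t (f ∘ a) (g ∘ b) := by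
  funext x
  by_cases hx : t x <;> simp [tagged, hx]

variable [DecidableEq X]

theorem exists_linearMap_lift_tagged_update_eq (t : X → Bool) (a : X → A) (b : X → B) {i : X}
    {w : FreeSemigroup X} (hw : letterCount i w = 1) :
    ∃ L : A × B →ₗ[ℂ] Coprod A B, ∀ a' b', FreeSemigroup.lift
      (tagged t (Function.update a i a') (Function.update b i b')) w = L (a', b') := by
  obtain ⟨L, hL⟩ := exists_linearMap_lift_update_eq ℂ (tagged t a b) hw
  have tagged_update (a' : A) (b' : B) :
      tagged t (Function.update a i a') (Function.update b i b') =
        Function.update (tagged t a b) i (if t i then Coprod.inr b' else Coprod.inl a') := by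
    funext x
    rcases eq_or_ne x i with rfl | hx <;> simp [tagged, *]
  by_cases hi : t i
  · exact ⟨L ∘ₗ (Coprod.inr : B →ₙₐ[ℂ] Coprod A B) ∘ₗ LinearMap.snd ℂ A B, fun a' b' => by
      rw [tagged_update, hL, if_pos hi]; rfl⟩
  · exact ⟨L ∘ₗ (Coprod.inl : A →ₙₐ[ℂ] Coprod A B) ∘ₗ LinearMap.fst ℂ A B, fun a' b' => by
      rw [tagged_update, hL, if_neg hi]; rfl⟩

end tagged

/-- The moments of a pair of tuples of functionals along words in the elements `a x`, `b x`: at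
`(false, l, v)` the value of the `l`-th functional on `A` on the word `v` in the `a x`, at
`(true, l, v)` the value of the `l`-th functional on `B` on the word `v` in the `b x`. -/
def wordMoments {d : ℕ} {X A B : Type*} [NonUnitalRing A] [Module ℂ A] [NonUnitalRing B]
    [Module ℂ B] (φ₁ : DualTuple d A) (φ₂ : DualTuple d B) (a : X → A) (b : X → B) :
    Bool × Fin d × FreeSemigroup X → ℂ
  | (false, l, v) => φ₁ l (FreeSemigroup.lift a v)
  | (true, l, v) => φ₂ l (FreeSemigroup.lift b v)

namespace UAUProduct

variable {d m : ℕ} (P : UAUProduct.{u} d m) {X : Type u} (c : X → Fin m) (t : X → Bool) (l : Fin d)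

/-- The value of the `l`-th component of a product `φ₁ ⊙ φ₂` on a tagged word `w` in coloured
letters, as a function of the moments `u` of `φ₁` and `φ₂`. -/
def mixedMoment (w : FreeSemigroup X) (u : Bool × Fin d × FreeSemigroup X → ℂ) : ℂ :=
  P.prod (FacedAlg.ofColours c) (FacedAlg.ofColours c)
    (fun l => WordAlg.functional fun v => u (false, l, v))
    (fun l => WordAlg.functional fun v => u (true, l, v)) l
    (FreeSemigroup.lift (tagged t WordAlg.letter WordAlg.letter) w :
      Coprod (WordAlg X) (WordAlg X))

variable {c}

theorem prod_lift_tagged_eq_mixedMoment (A B : FacedAlg.{u} m) {a : X → A} {b : X → B}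
    (ha : ∀ x, a x ∈ A.face (c x)) (hb : ∀ x, b x ∈ B.face (c x))
    (φ₁ : DualTuple d A) (φ₂ : DualTuple d B) (w : FreeSemigroup X) :
    P.prod A B φ₁ φ₂ l (FreeSemigroup.lift (tagged t a b) w : Coprod A B) =
      P.mixedMoment c t l w (wordMoments φ₁ φ₂ a b) := by
  have comp_lift {C : Type u} [NonUnitalRing C] [Module ℂ C] [IsScalarTower ℂ C C]
      [SMulCommClass ℂ C C] (φ : DualTuple d C) (z : X → C) :
      φ.comp (WordAlg.lift z) =
        fun l => WordAlg.functional fun v => φ l (FreeSemigroup.lift z v) := by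
    funext l
    rw [← WordAlg.functional_apply_word (φ.comp (WordAlg.lift z) l)]
    exact congrArg _ (funext fun v => congrArg (φ l) (WordAlg.lift_word z v))
  have lift_tagged : FreeSemigroup.lift (tagged t a b) w =
      Coprod.map (WordAlg.lift a) (WordAlg.lift b)
        (FreeSemigroup.lift (tagged t WordAlg.letter WordAlg.letter) w) := by
    rw [map_freeSemigroup_lift, map_comp_tagged]
    congr 3 <;> funext x <;> simp
  have universal := P.universal A B (FacedAlg.ofColours c) (FacedAlg.ofColours c) (WordAlg.lift a)
    (WordAlg.lift b) (fun k _ hz => WordAlg.face_le_comap_lift ha k hz)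
    (fun k _ hz => WordAlg.face_le_comap_lift hb k hz) φ₁ φ₂
  rw [lift_tagged]
  refine (LinearMap.congr_fun (congrFun universal l) _).trans ?_
  exact congrArg₂ (fun ψ₁ ψ₂ => P.prod (FacedAlg.ofColours c) (FacedAlg.ofColours c) ψ₁ ψ₂ l _)
    (comp_lift φ₁ a) (comp_lift φ₂ b)

variable {t l} [DecidableEq X]

theorem mixedMoment_scale {w : FreeSemigroup X} {i : X} (hi : letterCount i w = 1)
    (u : Bool × Fin d × FreeSemigroup X → ℂ) (r : ℂ) :
    P.mixedMoment c t l w (fun j => r ^ letterCount i j.2.2 * u j) =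
      r * P.mixedMoment c t l w u := by
  let F : FacedAlg.{u} m := FacedAlg.ofColours c
  let φ (s : Bool) : DualTuple d (WordAlg X) := fun l => WordAlg.functional fun v => u (s, l, v)
  let a : X → WordAlg X := Function.update WordAlg.letter i (r • WordAlg.letter i)
  obtain ⟨L, hL⟩ := exists_linearMap_lift_tagged_update_eq t (WordAlg.letter (X := X))
    WordAlg.letter hi
  have ha (x : X) : a x ∈ WordAlg.face c (c x) := by
    rcases eq_or_ne x i with rfl | hx
    · simpa [a] using SMulMemClass.smul_mem r (WordAlg.letter_mem_face c x)
    · simpa [a, hx] using WordAlg.letter_mem_face c x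
  have moments : wordMoments (φ false) (φ true) a a = fun j => r ^ letterCount i j.2.2 * u j := by
    have apply_lift (s : Bool) (l : Fin d) (v : FreeSemigroup X) :
        φ s l (FreeSemigroup.lift a v) = r ^ letterCount i v * u (s, l, v) := by
      rw [lift_update_smul, map_smul, WordAlg.lift_letter_eq_word, WordAlg.functional_word,
        smul_eq_mul]
    funext ⟨s, l, v⟩
    cases s <;> exact apply_lift _ l v
  have lift_tagged : FreeSemigroup.lift (tagged t a a) w =
      r • FreeSemigroup.lift (tagged t WordAlg.letter WordAlg.letter) w := by
    have hletter := hL (WordAlg.letter i) (WordAlg.letter i)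
    rw [Function.update_eq_self] at hletter
    rw [hL, hletter, ← Prod.smul_mk, map_smul]
  rw [← moments]
  refine (P.prod_lift_tagged_eq_mixedMoment t l F F ha ha (φ false) (φ true) w).symm.trans ?_
  exact (congrArg _ lift_tagged).trans (map_smul (P.prod F F (φ false) (φ true) l) r _)

/-- The substitution `i ↦ γ i + δ ∗`, where `∗ = none` is an additional letter. -/
def splitLetter (i : X) (γ δ : ℂ) : X → WordAlg (Option X) :=
  Function.update (WordAlg.letter ∘ some) i (γ • WordAlg.letter (some i) + δ • WordAlg.letter none)

/-- The substitution `i ↦ α i`, `∗ ↦ β i`, where `∗ = none` is an additional letter. -/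
def mergeLetter (i : X) (α β : ℂ) (o : Option X) : WordAlg X :=
  o.elim (β • WordAlg.letter i) (Function.update WordAlg.letter i (α • WordAlg.letter i))

theorem lift_mergeLetter_splitLetter (i : X) (α β γ δ : ℂ) (v : FreeSemigroup X) :
    WordAlg.lift (mergeLetter i α β) (FreeSemigroup.lift (splitLetter i γ δ) v) =
      (γ * α + δ * β) ^ letterCount i v • WordAlg.word v := by
  rw [map_freeSemigroup_lift, ← WordAlg.lift_letter_eq_word, ← lift_update_smul]
  congr 2
  funext x
  rcases eq_or_ne x i with rfl | hx
  · simp [splitLetter, mergeLetter, add_smul, mul_smul]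
  · simp [splitLetter, mergeLetter, hx]

theorem splitLetter_mem_face (i : X) (γ δ : ℂ) (x : X) :
    splitLetter i γ δ x ∈ WordAlg.face (fun o : Option X => o.elim (c i) c) (c x) := by
  rcases eq_or_ne x i with rfl | hx
  · rw [splitLetter, Function.update_self]
    exact add_mem (SMulMemClass.smul_mem _ (WordAlg.letter_mem_face _ (some x)))
      (SMulMemClass.smul_mem _ (WordAlg.letter_mem_face _ none))
  · rw [splitLetter, Function.update_of_ne hx]
    exact WordAlg.letter_mem_face (fun o : Option X => o.elim (c i) c) (some x)

/- On the word `v` split at `i ↦ γ i + δ ∗`, the functional `F ∘ p(1,0) + G ∘ p(0,1) + H ∘ p(1,1)`,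
where `p(α,β)` merges `i ↦ α i`, `∗ ↦ β i`, takes the value `γ ^ k F + δ ^ k G + (γ + δ) ^ k H`
with `k` the number of occurrences of `i`; one solves for the three required values. -/
theorem exists_functional_splitLetter (i : X) {f g h : FreeSemigroup X → ℂ}
    (h₀ : ∀ v, letterCount i v = 0 → f v = h v ∧ g v = h v)
    (h₁ : ∀ v, letterCount i v = 1 → h v = f v + g v) :
    ∃ Ψ : WordAlg (Option X) →ₗ[ℂ] ℂ, ∀ v,
      Ψ (FreeSemigroup.lift (splitLetter i 1 0) v) = f v ∧
      Ψ (FreeSemigroup.lift (splitLetter i 0 1) v) = g v ∧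
      Ψ (FreeSemigroup.lift (splitLetter i 1 1) v) = h v := by
  let H (v : FreeSemigroup X) : ℂ :=
    if letterCount i v ≤ 1 then 0 else (h v - f v - g v) / (2 ^ letterCount i v - 2)
  let G (v : FreeSemigroup X) : ℂ := if letterCount i v = 0 then 0 else g v - H v
  let p (α β : ℂ) : WordAlg (Option X) →ₗ[ℂ] WordAlg X :=
    (WordAlg.lift (mergeLetter i α β) : WordAlg (Option X) →ₙₐ[ℂ] WordAlg X)
  have functional_p (F : FreeSemigroup X → ℂ) (α β γ δ : ℂ) (v : FreeSemigroup X) :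
      WordAlg.functional F (p α β (FreeSemigroup.lift (splitLetter i γ δ) v)) =
        (γ * α + δ * β) ^ letterCount i v * F v := by
    refine (congrArg _ (lift_mergeLetter_splitLetter i α β γ δ v)).trans ?_
    rw [map_smul, WordAlg.functional_word, smul_eq_mul]
  refine ⟨WordAlg.functional (fun v => f v - H v) ∘ₗ p 1 0 + WordAlg.functional G ∘ₗ p 0 1 +
    WordAlg.functional H ∘ₗ p 1 1, fun v => ?_⟩
  simp only [LinearMap.add_apply, LinearMap.comp_apply, functional_p]
  rcases Nat.lt_trichotomy (letterCount i v) 1 with hv | hv | hv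
  · have hv₀ : letterCount i v = 0 := Nat.lt_one_iff.1 hv
    simp [H, G, hv₀, h₀ v hv₀]
  · simp [H, G, hv, h₁ v hv]
  · have hH : (2 ^ letterCount i v - 2) * H v = h v - f v - g v := by
      have two_lt : 2 ^ 1 < 2 ^ letterCount i v := Nat.pow_lt_pow_right one_lt_two hv
      have ne_zero : (2 ^ letterCount i v - 2 : ℂ) ≠ 0 :=
        sub_ne_zero.2 (by exact_mod_cast two_lt.ne')
      simp only [H, if_neg hv.not_ge]
      field_simp
    have hv₀ : letterCount i v ≠ 0 := by omega
    simp only [G, if_neg hv₀]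
    norm_num [hv₀]
    linear_combination hH

theorem mixedMoment_add {w : FreeSemigroup X} {i : X} (hi : letterCount i w = 1)
    {f g h : Bool × Fin d × FreeSemigroup X → ℂ}
    (h₀ : ∀ j, letterCount i j.2.2 = 0 → f j = h j ∧ g j = h j)
    (h₁ : ∀ j, letterCount i j.2.2 = 1 → h j = f j + g j) :
    P.mixedMoment c t l w h = P.mixedMoment c t l w f + P.mixedMoment c t l w g := by
  let F : FacedAlg.{u} m := FacedAlg.ofColours fun o : Option X => o.elim (c i) c
  choose Ψ hf hg hh using fun s l =>
    exists_functional_splitLetter i (fun v => h₀ (s, l, v)) (fun v => h₁ (s, l, v))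
  obtain ⟨L, hL⟩ := exists_linearMap_lift_tagged_update_eq t
    (WordAlg.letter ∘ some : X → WordAlg (Option X)) (WordAlg.letter ∘ some) hi
  let word (γ δ : ℂ) : Coprod (WordAlg (Option X)) (WordAlg (Option X)) :=
    FreeSemigroup.lift (tagged t (splitLetter i γ δ) (splitLetter i γ δ)) w
  have prod_word {u : Bool × Fin d × FreeSemigroup X → ℂ} {γ δ : ℂ}
      (hu : ∀ s l v, Ψ s l (FreeSemigroup.lift (splitLetter i γ δ) v) = u (s, l, v)) :
      P.prod F F (Ψ false) (Ψ true) l (word γ δ) = P.mixedMoment c t l w u := by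
    refine (P.prod_lift_tagged_eq_mixedMoment t l F F (splitLetter_mem_face i γ δ)
      (splitLetter_mem_face i γ δ) (Ψ false) (Ψ true) w).trans (congrArg _ (funext ?_))
    rintro ⟨_ | _, l, v⟩ <;> exact hu _ l v
  have word_add : word 1 1 = word 1 0 + word 0 1 := by
    simp only [word, splitLetter, hL, ← map_add]
    simp
  rw [← prod_word hf, ← prod_word hg, ← prod_word hh, word_add]
  exact map_add (P.prod F F (Ψ false) (Ψ true) l) _ _

theorem mixedMoment_congr_of_letterCount_le_one {w : FreeSemigroup X} {i : X}
    (hi : letterCount i w = 1) {u u' : Bool × Fin d × FreeSemigroup X → ℂ}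
    (h : ∀ j, letterCount i j.2.2 ≤ 1 → u j = u' j) :
    P.mixedMoment c t l w u = P.mixedMoment c t l w u' := by
  let z (j : Bool × Fin d × FreeSemigroup X) : ℂ := if letterCount i j.2.2 = 0 then u j else 0
  have add_z {u' : Bool × Fin d × FreeSemigroup X → ℂ}
      (h : ∀ j, letterCount i j.2.2 ≤ 1 → u j = u' j) :
      P.mixedMoment c t l w u' = P.mixedMoment c t l w u + P.mixedMoment c t l w z :=
    P.mixedMoment_add hi (fun j hj => by simp [z, hj, h j (by omega)])
      fun j hj => by simp [z, hj, h j (by omega)]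
  rw [add_z h, ← add_z fun _ _ => rfl]

theorem mixedMoment_congr [Finite X] {w : FreeSemigroup X} (hw : ∀ x, letterCount x w = 1)
    {u u' : Bool × Fin d × FreeSemigroup X → ℂ}
    (h : ∀ j, (∀ x, letterCount x j.2.2 ≤ 1) → u j = u' j) :
    P.mixedMoment c t l w u = P.mixedMoment c t l w u' := by
  have := Fintype.ofFinite X
  suffices congr_on : ∀ (S : Finset X) (u : Bool × Fin d × FreeSemigroup X → ℂ),
      (∀ j, (∀ x ∈ S, letterCount x j.2.2 ≤ 1) → u j = u' j) →
        P.mixedMoment c t l w u = P.mixedMoment c t l w u' from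
    congr_on Finset.univ u fun j hj => h j fun x => hj x (Finset.mem_univ x)
  clear u h
  intro S u h
  induction S using Finset.induction_on generalizing u with
  | empty => exact congrArg _ (funext fun j => h j (by simp))
  | insert i S _ ih =>
    let u₁ (j : Bool × Fin d × FreeSemigroup X) : ℂ :=
      if letterCount i j.2.2 ≤ 1 then u j else u' j
    refine (P.mixedMoment_congr_of_letterCount_le_one (hw i) (u' := u₁)
      fun j hj => (if_pos hj).symm).trans (ih u₁ fun j hj => ?_)
    by_cases hi : letterCount i j.2.2 ≤ 1
    · simpa [u₁, hi] using h j (by simpa [hi] using hj)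
    · simp [u₁, hi]

theorem mixedMoment_update {w : FreeSemigroup X} (hw : ∀ x, letterCount x w = 1)
    (u : Bool × Fin d × FreeSemigroup X → ℂ) (j : Bool × Fin d × FreeSemigroup X) (r : ℂ) :
    P.mixedMoment c t l w (Function.update u j r) =
      P.mixedMoment c t l w (Function.update u j 0) +
      r * (P.mixedMoment c t l w (Function.update u j 1) -
        P.mixedMoment c t l w (Function.update u j 0)) := by
  let i := j.2.2.head
  have hj : letterCount i j.2.2 ≠ 0 := (letterCount_head_pos _).ne'
  let z : ℂ → Bool × Fin d × FreeSemigroup X → ℂ :=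
    Function.update (fun k => if letterCount i k.2.2 = 0 then u k else 0) j
  have update_eq_add (r : ℂ) : P.mixedMoment c t l w (Function.update u j r) =
      P.mixedMoment c t l w (Function.update u j 0) + P.mixedMoment c t l w (z r) := by
    refine P.mixedMoment_add (hw i) (fun k hk => ?_) (fun k hk => ?_)
    · have hkj : k ≠ j := fun e => hj (e ▸ hk)
      simp [z, hkj, hk]
    · rcases eq_or_ne k j with rfl | hkj <;> simp [z, *]
  have z_eq_smul (r : ℂ) : P.mixedMoment c t l w (z r) = r * P.mixedMoment c t l w (z 1) := by
    rw [← P.mixedMoment_scale (hw i)]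
    refine P.mixedMoment_congr_of_letterCount_le_one (hw i) fun k hk => ?_
    rcases eq_or_ne k j with rfl | hkj
    · have hk₁ : letterCount i k.2.2 = 1 := by omega
      simp [z, hk₁]
    · by_cases hk₀ : letterCount i k.2.2 = 0 <;> simp [z, hkj, hk₀]
  rw [update_eq_add r, update_eq_add 1, z_eq_smul r]
  ring

end UAUProduct

theorem exists_mvPolynomial_eval_eq {R ι : Type*} [CommRing R] [DecidableEq ι] {F : (ι → R) → R}
    (S : Finset ι) (hS : ∀ u u', (∀ j ∈ S, u j = u' j) → F u = F u')
    (hF : ∀ u j r, F (Function.update u j r) = F (Function.update u j 0) +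
      r * (F (Function.update u j 1) - F (Function.update u j 0))) :
    ∃ p : MvPolynomial ι R, ∀ u, MvPolynomial.eval u p = F u := by
  induction S using Finset.induction_on generalizing F with
  | empty => exact ⟨MvPolynomial.C (F 0), fun u => by simpa using hS 0 u (by simp)⟩
  | insert j S hj ih =>
    have restrict (s : R) : ∃ p : MvPolynomial ι R, ∀ u,
        MvPolynomial.eval u p = F (Function.update u j s) := by
      refine ih (fun u u' h => hS _ _ fun k hk => ?_) fun u k r => ?_
      · rcases eq_or_ne k j with rfl | hkj
        · simp
        · simpa [hkj] using h k ((Finset.mem_insert.1 hk).resolve_left hkj)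
      · rcases eq_or_ne k j with rfl | hkj
        · simp
        · simpa only [Function.update_comm hkj] using hF (Function.update u j s) k r
    obtain ⟨p₀, hp₀⟩ := restrict 0
    obtain ⟨p₁, hp₁⟩ := restrict 1
    refine ⟨p₀ + MvPolynomial.X j * (p₁ - p₀), fun u => ?_⟩
    simpa [hp₀, hp₁] using (hF u j (u j)).symm

theorem UAUProduct.exists_mvPolynomial_eval_eq_mixedMoment {d m : ℕ} (P : UAUProduct.{u} d m)
    {X : Type u} [Finite X] [DecidableEq X] (c : X → Fin m) (t : X → Bool) (l : Fin d)
    {w : FreeSemigroup X} (hw : ∀ x, letterCount x w = 1) :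
    ∃ p : MvPolynomial (Bool × Fin d × FreeSemigroup X) ℂ,
      ∀ u, MvPolynomial.eval u p = P.mixedMoment c t l w u := by
  have finite_words : {j : Bool × Fin d × FreeSemigroup X | ∀ x, letterCount x j.2.2 ≤ 1}.Finite :=
    (Set.finite_univ.prod (Set.finite_univ.prod finite_setOf_letterCount_le_one)).subset
      fun j hj => ⟨trivial, trivial, hj⟩
  refine exists_mvPolynomial_eval_eq finite_words.toFinset (fun u u' h => ?_)
    (P.mixedMoment_update hw)
  exact P.mixedMoment_congr hw fun j hj => h j (by simpa using hj)

/-! ## Separating families of characters -/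

section IsSeparating

variable {K ι κ B C : Type*} [Field K] [Ring B] [Algebra K B] [Ring C] [Algebra K C]

/-- A family of characters is separating if only `0` is annihilated by all of them. -/
def IsSeparating (F : ι → B →ₐ[K] K) : Prop :=
  ∀ x, (∀ i, F i x = 0) → x = 0

theorem IsSeparating.ext {F : ι → B →ₐ[K] K} (hF : IsSeparating F) {x y : B}
    (h : ∀ i, F i x = F i y) : x = y :=
  sub_eq_zero.1 (hF _ fun i => by rw [map_sub, h, sub_self])

theorem IsSeparating.algHom_ext {F : ι → B →ₐ[K] K} (hF : IsSeparating F) {f g : C →ₐ[K] B}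
    (h : ∀ i, (F i).comp f = (F i).comp g) : f = g :=
  AlgHom.ext fun x => hF.ext fun i => DFunLike.congr_fun (h i) x

theorem IsSeparating.tensor {F : ι → B →ₐ[K] K} {G : κ → C →ₐ[K] K} (hF : IsSeparating F)
    (hG : IsSeparating G) :
    IsSeparating fun p : ι × κ => Algebra.TensorProduct.productMap (F p.1) (G p.2) := by
  classical
  intro t ht
  let b := Module.Basis.ofVectorSpace K C
  let e := TensorProduct.equivFinsuppOfBasisRight (M := B) b
  have sum_coeff_smul (i : ι) : ∑ k ∈ (e t).support, F i (e t k) • b k = 0 := by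
    refine hG _ fun j => ?_
    have h := ht (i, j)
    rw [← e.symm_apply_apply t, TensorProduct.equivFinsuppOfBasisRight_symm_apply,
      Finsupp.sum, map_sum] at h
    simpa [map_sum] using h
  refine (map_eq_zero_iff e e.injective).1 (Finsupp.ext fun k => hF _ fun i => ?_)
  by_cases hk : k ∈ (e t).support
  · exact linearIndependent_iff'.1 b.linearIndependent _ _ (sum_coeff_smul i) k hk
  · rw [Finsupp.notMem_support_iff.1 hk, map_zero]

theorem isSeparating_symmetricAlgebra_lift (K W : Type*) [Field K] [Infinite K] [AddCommGroup W]
    [Module K W] : IsSeparating fun f : W →ₗ[K] K => SymmetricAlgebra.lift f := by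
  intro x hx
  let b := Module.Basis.ofVectorSpace K W
  let e := SymmetricAlgebra.equivMvPolynomial b
  have aeval_equiv (p : Module.Basis.ofVectorSpaceIndex K W → K) :
      (MvPolynomial.aeval p).comp (e : SymmetricAlgebra K W →ₐ[K] _) =
        SymmetricAlgebra.lift (b.constr K p) := by
    refine SymmetricAlgebra.algHom_ext (b.ext fun i => ?_)
    simp [e]
  refine (map_eq_zero_iff e e.injective).1 (MvPolynomial.funext fun p => ?_)
  have h := DFunLike.congr_fun (aeval_equiv p) x
  rw [hx] at h
  simpa [MvPolynomial.aeval_eq_eval] using h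

end IsSeparating

namespace DualTuple

variable {d : ℕ} {W : Type*} [AddCommGroup W] [Module ℂ W]

theorem total_apply (φ : DualTuple d W) (x : Fin d → W) : φ.total x = ∑ l, φ l (x l) := by
  simp [total]

theorem total_single (φ : DualTuple d W) (l : Fin d) (a : W) :
    φ.total (Pi.single l a) = φ l a := by
  rw [total_apply, Finset.sum_eq_single l (fun k _ hk => by simp [hk]) (by simp),
    Pi.single_eq_same]

theorem total_zero : (0 : DualTuple d W).total = 0 := by
  ext; simp [total_apply]

theorem total_surjective : Function.Surjective (total : DualTuple d W → _) := fun f =>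
  ⟨fun l => f ∘ₗ LinearMap.single ℂ (fun _ => W) l, by ext; simp [total_single]⟩

theorem total_comp {A B : Type*} [NonUnitalRing A] [Module ℂ A] [NonUnitalRing B] [Module ℂ B]
    (φ : DualTuple d A) (j : B →ₙₐ[ℂ] A) :
    (φ.comp j).total = φ.total ∘ₗ (j : B →ₗ[ℂ] A).compLeft (Fin d) := by
  refine LinearMap.ext fun x => ?_
  rw [LinearMap.comp_apply, total_apply, total_apply]
  rfl

/-- The character `S(φ)` of `S(W^d)` which extends a tuple `φ` of functionals on `W`. -/
def char (φ : DualTuple d W) : SymmetricAlgebra ℂ (Fin d → W) →ₐ[ℂ] ℂ :=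
  SymmetricAlgebra.lift φ.total

@[simp]
theorem char_ι (φ : DualTuple d W) (x : Fin d → W) :
    φ.char (SymmetricAlgebra.ι ℂ _ x) = φ.total x :=
  SymmetricAlgebra.lift_ι_apply _ _

theorem isSeparating_char (d : ℕ) (W : Type*) [AddCommGroup W] [Module ℂ W] :
    IsSeparating (char : DualTuple d W → _) := fun x hx =>
  isSeparating_symmetricAlgebra_lift ℂ _ x fun f => by
    obtain ⟨φ, rfl⟩ := total_surjective f
    exact hx φ

end DualTuple

/-! ## The universal coefficients of a product -/

namespace FacedAlg

variable {m : ℕ} (A B : FacedAlg.{u} m)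

/-- The letters for a free product of faced algebras: a tag for one of the factors, a colour `k`,
and an element of the `k`-th face of each factor, of which only the one in the tagged factor is
read. -/
abbrev TaggedLetter : Type u := Bool × Σ k, A.face k × B.face k

/-- The presentation of a free product of faced algebras by its tagged letters. -/
def evalTagged : WordAlg (A.TaggedLetter B) →ₙₐ[ℂ] Coprod A B :=
  WordAlg.lift (tagged Prod.fst (fun y => (y.2.2.1 : A)) fun y => (y.2.2.2 : B))

theorem evalTagged_surjective : Function.Surjective (A.evalTagged B) := by
  have inl_mem (a : A) : Coprod.inl a ∈ NonUnitalAlgHom.range (A.evalTagged B) :=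
    (A.eq_top_of_face_le (N := (NonUnitalAlgHom.range (A.evalTagged B)).comap Coprod.inl)
      fun k a ha => ⟨WordAlg.letter (false, ⟨k, ⟨a, ha⟩, 0⟩), WordAlg.lift_letter _ _⟩).ge
        NonUnitalAlgebra.mem_top
  have inr_mem (b : B) : Coprod.inr b ∈ NonUnitalAlgHom.range (A.evalTagged B) :=
    (B.eq_top_of_face_le (N := (NonUnitalAlgHom.range (A.evalTagged B)).comap Coprod.inr)
      fun k b hb => ⟨WordAlg.letter (true, ⟨k, 0, ⟨b, hb⟩⟩), WordAlg.lift_letter _ _⟩).ge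
        NonUnitalAlgebra.mem_top
  exact fun x => (Coprod.eq_top_of_mem inl_mem inr_mem).ge (NonUnitalAlgebra.mem_top (x := x))

end FacedAlg

namespace UAUProduct

open Algebra.TensorProduct

variable {d m : ℕ} (P : UAUProduct.{u} d m) {A B : FacedAlg.{u} m}

theorem exists_productMap_char_eq_prod_word {X : Type u} {c : X → Fin m} (t : X → Bool)
    {a : X → A} {b : X → B} (ha : ∀ x, a x ∈ A.face (c x)) (hb : ∀ x, b x ∈ B.face (c x))
    (l : Fin d) (w : FreeSemigroup X) :
    ∃ s, ∀ (φ₁ : DualTuple d A) (φ₂ : DualTuple d B), productMap φ₁.char φ₂.char s =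
      P.prod A B φ₁ φ₂ l (FreeSemigroup.lift (tagged t a b) w : Coprod A B) := by
  obtain ⟨X₀, _, _, g, v, hv, rfl⟩ := exists_multilinear_word w
  obtain ⟨p, hp⟩ := P.exists_mvPolynomial_eval_eq_mixedMoment (c ∘ g) (t ∘ g) l hv
  let moment : Bool × Fin d × FreeSemigroup X₀ →
      SymmetricAlgebra ℂ (Fin d → A) ⊗[ℂ] SymmetricAlgebra ℂ (Fin d → B)
    | (false, l, v) => SymmetricAlgebra.ι ℂ _ (Pi.single l (FreeSemigroup.lift (a ∘ g) v)) ⊗ₜ 1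
    | (true, l, v) => 1 ⊗ₜ SymmetricAlgebra.ι ℂ _ (Pi.single l (FreeSemigroup.lift (b ∘ g) v))
  refine ⟨MvPolynomial.aeval moment p, fun φ₁ φ₂ => ?_⟩
  have productMap_moment : productMap φ₁.char φ₂.char ∘ moment =
      wordMoments φ₁ φ₂ (a ∘ g) (b ∘ g) := by
    funext ⟨s, l, v⟩
    cases s <;> simp [moment, wordMoments, DualTuple.total_single]
  have lift_tagged : FreeSemigroup.lift (tagged t a b) (FreeSemigroup.map g v) =
      FreeSemigroup.lift (tagged (t ∘ g) (a ∘ g) (b ∘ g)) v :=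
    freeSemigroup_lift_map _ _ _
  have productMap_aeval : productMap φ₁.char φ₂.char (MvPolynomial.aeval moment p) =
      MvPolynomial.eval (wordMoments φ₁ φ₂ (a ∘ g) (b ∘ g)) p := by
    rw [← productMap_moment, ← MvPolynomial.aeval_eq_eval]
    exact MvPolynomial.comp_aeval_apply (f := moment) (productMap φ₁.char φ₂.char) p
  rw [productMap_aeval, hp, lift_tagged]
  exact (P.prod_lift_tagged_eq_mixedMoment (t ∘ g) l A B (fun x => ha (g x)) (fun x => hb (g x))
    φ₁ φ₂ v).symm

theorem exists_productMap_char_eq_prod (l : Fin d) (x : A.prod B) :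
    ∃ s, ∀ (φ₁ : DualTuple d A) (φ₂ : DualTuple d B),
      productMap φ₁.char φ₂.char s = P.prod A B φ₁ φ₂ l x := by
  obtain ⟨q, rfl⟩ := A.evalTagged_surjective B x
  let L (φ₁ : DualTuple d A) (φ₂ : DualTuple d B) : WordAlg (A.TaggedLetter B) →ₗ[ℂ] ℂ :=
    (P.prod A B φ₁ φ₂ l : Coprod A B →ₗ[ℂ] ℂ) ∘ₗ (A.evalTagged B : _ →ₗ[ℂ] Coprod A B)
  change ∃ s, ∀ φ₁ φ₂, productMap (DualTuple.char φ₁) (DualTuple.char φ₂) s = L φ₁ φ₂ q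
  induction q using MonoidAlgebra.induction_linear with
  | zero => exact ⟨0, fun φ₁ φ₂ => by simp only [map_zero]⟩
  | add q r hq hr =>
    obtain ⟨s, hs⟩ := hq
    obtain ⟨s', hs'⟩ := hr
    exact ⟨s + s', fun φ₁ φ₂ => by simp only [map_add, hs, hs']⟩
  | single w r =>
    obtain ⟨s, hs⟩ := P.exists_productMap_char_eq_prod_word (A := A) (B := B)
      (c := fun y : A.TaggedLetter B => y.2.1) Prod.fst (fun y => y.2.2.1.2)
      (fun y => y.2.2.2.2) l w
    refine ⟨r • s, fun φ₁ φ₂ => ?_⟩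
    have single_eq : MonoidAlgebra.single w r = r • WordAlg.word w := by simp [WordAlg.word]
    rw [single_eq, map_smul, map_smul, hs]
    exact congrArg (fun z : Coprod A B => r • P.prod A B φ₁ φ₂ l z) (WordAlg.lift_word _ w).symm

theorem isSigma_iff {σ : (Fin d → A.prod B) →ₗ[ℂ]
    SymmetricAlgebra ℂ (Fin d → A) ⊗[ℂ] SymmetricAlgebra ℂ (Fin d → B)} :
    P.IsSigma A B σ ↔ ∀ φ₁ φ₂ x,
      productMap (DualTuple.char φ₁) (DualTuple.char φ₂) (σ x) = (P.prod A B φ₁ φ₂).total x := by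
  simp only [productMap_eq_comp_map, IsSigma, eq_comm]
  rfl

theorem isSeparating_productMap_char (d : ℕ) (A B : FacedAlg.{u} m) :
    IsSeparating fun φ : DualTuple d A × DualTuple d B => productMap φ.1.char φ.2.char :=
  (DualTuple.isSeparating_char d A).tensor (DualTuple.isSeparating_char d B)

variable (A B)

theorem existsUnique_isSigma : ∃! σ, P.IsSigma A B σ := by
  choose s hs using fun l (x : A.prod B) => P.exists_productMap_char_eq_prod l x
  have productMap_sum (φ₁ : DualTuple d A) (φ₂ : DualTuple d B) (x : Fin d → A.prod B) :
      productMap φ₁.char φ₂.char (∑ l, s l (x l)) = (P.prod A B φ₁ φ₂).total x := by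
    simp [hs, DualTuple.total_apply]
  let σ : (Fin d → A.prod B) →ₗ[ℂ]
      SymmetricAlgebra ℂ (Fin d → A) ⊗[ℂ] SymmetricAlgebra ℂ (Fin d → B) :=
    { toFun x := ∑ l, s l (x l)
      map_add' x y := (isSeparating_productMap_char d A B).ext fun φ => by
        simp only [map_add, productMap_sum]
      map_smul' r x := (isSeparating_productMap_char d A B).ext fun φ => by
        simp only [map_smul, productMap_sum, RingHom.id_apply] }
  refine ⟨σ, P.isSigma_iff.2 productMap_sum, fun τ hτ => LinearMap.ext fun x => ?_⟩
  exact (isSeparating_productMap_char d A B).ext fun φ =>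
    (P.isSigma_iff.1 hτ φ.1 φ.2 x).trans (productMap_sum φ.1 φ.2 x).symm

theorem isSigma_sigma : P.IsSigma A B (P.sigma A B) := by
  have h := (P.existsUnique_isSigma A B).exists
  rw [sigma, dif_pos h]
  exact h.choose_spec

variable {A B}

theorem productMap_char_sigma (φ₁ : DualTuple d A) (φ₂ : DualTuple d B) (x : Fin d → A.prod B) :
    productMap φ₁.char φ₂.char (P.sigma A B x) = (P.prod A B φ₁ φ₂).total x :=
  P.isSigma_iff.1 (P.isSigma_sigma A B) φ₁ φ₂ x

end UAUProduct

/-! ## Powers of dual semigroups -/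

namespace Coprod

section Map

variable {A B C A' B' C' A'' B'' : Type u}
  [NonUnitalRing A] [Module ℂ A] [IsScalarTower ℂ A A] [SMulCommClass ℂ A A]
  [NonUnitalRing B] [Module ℂ B] [IsScalarTower ℂ B B] [SMulCommClass ℂ B B]
  [NonUnitalRing C] [Module ℂ C] [IsScalarTower ℂ C C] [SMulCommClass ℂ C C]
  [NonUnitalRing A'] [Module ℂ A'] [IsScalarTower ℂ A' A'] [SMulCommClass ℂ A' A']
  [NonUnitalRing B'] [Module ℂ B'] [IsScalarTower ℂ B' B'] [SMulCommClass ℂ B' B']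
  [NonUnitalRing C'] [Module ℂ C'] [IsScalarTower ℂ C' C'] [SMulCommClass ℂ C' C']
  [NonUnitalRing A''] [Module ℂ A''] [IsScalarTower ℂ A'' A''] [SMulCommClass ℂ A'' A'']
  [NonUnitalRing B''] [Module ℂ B''] [IsScalarTower ℂ B'' B''] [SMulCommClass ℂ B'' B'']

theorem map_comp_map (k₁ : A' →ₙₐ[ℂ] A'') (k₂ : B' →ₙₐ[ℂ] B'') (j₁ : A →ₙₐ[ℂ] A')
    (j₂ : B →ₙₐ[ℂ] B') : (map k₁ k₂).comp (map j₁ j₂) = map (k₁.comp j₁) (k₂.comp j₂) :=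
  hom_ext (fun a => by simp) (fun b => by simp)

theorem map_map (k₁ : A' →ₙₐ[ℂ] A'') (k₂ : B' →ₙₐ[ℂ] B'') (j₁ : A →ₙₐ[ℂ] A')
    (j₂ : B →ₙₐ[ℂ] B') (x : Coprod A B) :
    map k₁ k₂ (map j₁ j₂ x) = map (k₁.comp j₁) (k₂.comp j₂) x :=
  DFunLike.congr_fun (map_comp_map k₁ k₂ j₁ j₂) x

theorem map_mem {N : NonUnitalSubalgebra ℂ (Coprod A' B')} {j₁ : A →ₙₐ[ℂ] A'}
    {j₂ : B →ₙₐ[ℂ] B'} (h₁ : ∀ a, inl (j₁ a) ∈ N) (h₂ : ∀ b, inr (j₂ b) ∈ N) (x : Coprod A B) :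
    map j₁ j₂ x ∈ N :=
  (eq_top_of_mem (N := N.comap (map j₁ j₂)) (fun a => by simpa using h₁ a)
    (fun b => by simpa using h₂ b)).ge NonUnitalAlgebra.mem_top

theorem assoc_map (f : A →ₙₐ[ℂ] A') (g : B →ₙₐ[ℂ] B') (h : C →ₙₐ[ℂ] C')
    (x : Coprod A (Coprod B C)) :
    assoc A' B' C' (map f (map g h) x) = map (map f g) h (assoc A B C x) := by
  have on_right : ((assoc A' B' C').comp (map f (map g h))).comp inr =
      ((map (map f g) h).comp (assoc A B C)).comp inr :=
    hom_ext (fun b => by simp [assoc]) (fun c => by simp [assoc])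
  have comp_eq : (assoc A' B' C').comp (map f (map g h)) =
      (map (map f g) h).comp (assoc A B C) :=
    hom_ext (fun a => by simp [assoc]) (DFunLike.congr_fun on_right)
  exact DFunLike.congr_fun comp_eq x

end Map

end Coprod

namespace FacedAlg

variable {m : ℕ} {D : Type u} [NonUnitalRing D] [Module ℂ D] [IsScalarTower ℂ D D]
  [SMulCommClass ℂ D D]

/-- The embedding of `D` as the `k`-th face of `D^{⊔ m}`. -/
def powerι (k : Fin m) : D →ₙₐ[ℂ] power m D :=
  FreeProd.ι (A := fun _ : Fin m => D) k

theorem power_hom_ext {B : Type*} [NonUnitalRing B] [Module ℂ B] [IsScalarTower ℂ B B]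
    [SMulCommClass ℂ B B] {f g : power m D →ₙₐ[ℂ] B}
    (h : ∀ k, f.comp (powerι k) = g.comp (powerι k)) : f = g :=
  FreeProd.hom_ext (A := fun _ : Fin m => D) fun k => DFunLike.congr_fun (h k)

theorem RespectsFaces.id (A : FacedAlg.{u} m) : RespectsFaces A A (NonUnitalAlgHom.id ℂ A) :=
  fun _ _ ha => ha

theorem RespectsFaces.zero (A B : FacedAlg.{u} m) : RespectsFaces A B 0 :=
  fun k _ _ => zero_mem (B.face k)

end FacedAlg

namespace DualSemigroup

open FacedAlg

variable {D : Type u} [NonUnitalRing D] [Module ℂ D] [IsScalarTower ℂ D D] [SMulCommClass ℂ D D]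
  (S : DualSemigroup D) (m : ℕ)

/-- The homomorphism `Δ^{⊔ m}` into `D^{⊔ m} ⊔ D^{⊔ m}` regarded as a plain algebra. -/
def powerComul : FacedAlg.power m D →ₙₐ[ℂ] Coprod (FacedAlg.power m D) (FacedAlg.power m D) :=
  S.powerΔ m

theorem powerComul_powerι (k : Fin m) (a : D) :
    S.powerComul m (powerι k a) = Coprod.map (powerι k) (powerι k) (S.Δ a) :=
  FreeProd.lift_ι (A := fun _ : Fin m => D)
    (B := Coprod (FacedAlg.power m D) (FacedAlg.power m D)) _ k a

section Extend

variable {E : Type u} [NonUnitalRing E] [Module ℂ E] [IsScalarTower ℂ E E] [SMulCommClass ℂ E E]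
  {Δ' : E →ₙₐ[ℂ] Coprod E E} {f : D →ₙₐ[ℂ] E}

variable {S}

theorem coassoc_apply_of_comp_eq (h : Δ'.comp f = (Coprod.map f f).comp S.Δ) (a : D) :
    Coprod.map Δ' (NonUnitalAlgHom.id ℂ E) (Δ' (f a)) =
      Coprod.assoc E E E (Coprod.map (NonUnitalAlgHom.id ℂ E) Δ' (Δ' (f a))) := by
  have comul_apply : Δ' (f a) = Coprod.map f f (S.Δ a) := DFunLike.congr_fun h a
  have id_comp : (NonUnitalAlgHom.id ℂ E).comp f = f.comp (NonUnitalAlgHom.id ℂ D) := rfl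
  have coassoc_apply := DFunLike.congr_fun S.coassoc a
  simp only [NonUnitalAlgHom.comp_apply] at coassoc_apply
  rw [comul_apply, Coprod.map_map, Coprod.map_map, h, id_comp, ← Coprod.map_map,
    ← Coprod.map_map, coassoc_apply, Coprod.assoc_map]

theorem counit_left_apply_of_comp_eq (h : Δ'.comp f = (Coprod.map f f).comp S.Δ) (a : D) :
    Coprod.map (0 : E →ₙₐ[ℂ] E) (NonUnitalAlgHom.id ℂ E) (Δ' (f a)) = Coprod.inr (f a) := by
  have comul_apply : Δ' (f a) = Coprod.map f f (S.Δ a) := DFunLike.congr_fun h a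
  have zero_comp : (0 : E →ₙₐ[ℂ] E).comp f = f.comp (0 : D →ₙₐ[ℂ] D) :=
    NonUnitalAlgHom.ext fun _ => (map_zero f).symm
  have id_comp : (NonUnitalAlgHom.id ℂ E).comp f = f.comp (NonUnitalAlgHom.id ℂ D) := rfl
  have counit_apply := DFunLike.congr_fun S.counit_left a
  rw [NonUnitalAlgHom.comp_apply] at counit_apply
  rw [comul_apply, Coprod.map_map, zero_comp, id_comp, ← Coprod.map_map, counit_apply,
    Coprod.map_inr]

theorem counit_right_apply_of_comp_eq (h : Δ'.comp f = (Coprod.map f f).comp S.Δ) (a : D) :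
    Coprod.map (NonUnitalAlgHom.id ℂ E) (0 : E →ₙₐ[ℂ] E) (Δ' (f a)) = Coprod.inl (f a) := by
  have comul_apply : Δ' (f a) = Coprod.map f f (S.Δ a) := DFunLike.congr_fun h a
  have zero_comp : (0 : E →ₙₐ[ℂ] E).comp f = f.comp (0 : D →ₙₐ[ℂ] D) :=
    NonUnitalAlgHom.ext fun _ => (map_zero f).symm
  have id_comp : (NonUnitalAlgHom.id ℂ E).comp f = f.comp (NonUnitalAlgHom.id ℂ D) := rfl
  have counit_apply := DFunLike.congr_fun S.counit_right a
  rw [NonUnitalAlgHom.comp_apply] at counit_apply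
  rw [comul_apply, Coprod.map_map, zero_comp, id_comp, ← Coprod.map_map, counit_apply,
    Coprod.map_inl]

end Extend

theorem powerComul_comp_powerι (k : Fin m) :
    (S.powerComul m).comp (powerι k) = (Coprod.map (powerι k) (powerι k)).comp S.Δ :=
  NonUnitalAlgHom.ext (S.powerComul_powerι m k)

/-- The dual semigroup `(D^{⊔ m}, Δ^{⊔ m})`. -/
def power : DualSemigroup (FacedAlg.power m D) where
  Δ := S.powerComul m
  coassoc := power_hom_ext fun k => NonUnitalAlgHom.ext fun a => by
    simp only [NonUnitalAlgHom.comp_apply]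
    exact coassoc_apply_of_comp_eq (S.powerComul_comp_powerι m k) a
  counit_left := power_hom_ext fun k => NonUnitalAlgHom.ext fun a =>
    counit_left_apply_of_comp_eq (S.powerComul_comp_powerι m k) a
  counit_right := power_hom_ext fun k => NonUnitalAlgHom.ext fun a =>
    counit_right_apply_of_comp_eq (S.powerComul_comp_powerι m k) a

theorem respectsFaces_powerΔ : RespectsFaces (FacedAlg.power m D)
    ((FacedAlg.power m D).prod (FacedAlg.power m D)) (S.powerΔ m) := by
  rintro k _ ⟨a, rfl⟩
  change S.powerComul m (powerι k a) ∈ prodFace (FacedAlg.power m D) (FacedAlg.power m D) k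
  rw [powerComul_powerι]
  exact Coprod.map_mem (fun b => NonUnitalAlgebra.subset_adjoin ℂ (Or.inl ⟨_, ⟨b, rfl⟩, rfl⟩))
    (fun b => NonUnitalAlgebra.subset_adjoin ℂ (Or.inr ⟨_, ⟨b, rfl⟩, rfl⟩)) (S.Δ a)

end DualSemigroup

/-! ## The bialgebra of a dual semigroup -/

section ProductMap

open Algebra.TensorProduct

variable {K A B C : Type*} [CommRing K] [CommRing A] [Algebra K A] [CommRing B] [Algebra K B]
  [CommRing C] [Algebra K C]

theorem productMap_comp_assoc_comp_map {A' : Type*} [CommRing A'] [Algebra K A']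
    (f : A →ₐ[K] K) (g : B →ₐ[K] K) (h : C →ₐ[K] K) (Δ : A' →ₐ[K] A ⊗[K] B) :
    (productMap f (productMap g h)).comp
        ((Algebra.TensorProduct.assoc K K K A B C).toAlgHom.comp (map Δ (AlgHom.id K C))) =
      productMap ((productMap f g).comp Δ) h := by
  have assoc_tmul_one (t : A ⊗[K] B) : productMap f (productMap g h)
      (Algebra.TensorProduct.assoc K K K A B C (t ⊗ₜ 1)) = productMap f g t := by
    induction t using TensorProduct.induction_on with
    | zero => simp
    | tmul a b => simp
    | add s t hs ht => rw [TensorProduct.add_tmul, map_add, map_add, map_add, hs, ht]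
  refine Algebra.TensorProduct.ext (AlgHom.ext fun x => ?_) (AlgHom.ext fun x => ?_)
  · simpa using assoc_tmul_one (Δ x)
  · simp [one_def]

theorem productMap_comp_map {A' B' : Type*} [CommRing A'] [Algebra K A'] [CommRing B']
    [Algebra K B'] (f : A →ₐ[K] K) (g : B →ₐ[K] K) (u : A' →ₐ[K] A) (v : B' →ₐ[K] B) :
    (productMap f g).comp (map u v) = productMap (f.comp u) (g.comp v) :=
  Algebra.TensorProduct.ext (AlgHom.ext fun x => by simp) (AlgHom.ext fun x => by simp)

theorem comp_lid_comp_map (f : A →ₐ[K] K) (ε : B →ₐ[K] K) :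
    f.comp ((Algebra.TensorProduct.lid K A).toAlgHom.comp (map ε (AlgHom.id K A))) =
      productMap ε f :=
  Algebra.TensorProduct.ext (AlgHom.ext fun x => by simp) (AlgHom.ext fun x => by simp)

theorem comp_rid_comp_map (f : A →ₐ[K] K) (ε : B →ₐ[K] K) :
    f.comp ((Algebra.TensorProduct.rid K K A).toAlgHom.comp (map (AlgHom.id K A) ε)) =
      productMap f ε :=
  Algebra.TensorProduct.ext (AlgHom.ext fun x => by simp) (AlgHom.ext fun x => by simp)

theorem isBialgebra_of_isSeparating {ι B : Type*} [CommRing B] [Algebra ℂ B]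
    {χ : ι → B →ₐ[ℂ] ℂ} (hχ : IsSeparating χ) {Δ : B →ₐ[ℂ] B ⊗[ℂ] B} (op : ι → ι → ι) (e : ι)
    (comul : ∀ i j, (productMap (χ i) (χ j)).comp Δ = χ (op i j))
    (assoc : ∀ i j k, op (op i j) k = op i (op j k)) (left_unit : ∀ i, op e i = i)
    (right_unit : ∀ i, op i e = i) : IsBialgebra Δ (χ e) where
  coassoc := by
    refine (hχ.tensor (hχ.tensor hχ)).algHom_ext fun i => ?_
    rw [← AlgHom.comp_assoc (Algebra.TensorProduct.assoc ℂ ℂ ℂ B B B).toAlgHom,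
      ← AlgHom.comp_assoc, productMap_comp_assoc_comp_map, comul, comul, assoc,
      ← AlgHom.comp_assoc, productMap_comp_map, AlgHom.comp_id, comul, comul]
  counit_left := hχ.algHom_ext fun i => by
    rw [← AlgHom.comp_assoc, ← AlgHom.comp_assoc, AlgHom.comp_assoc (χ i), comp_lid_comp_map,
      comul, left_unit, AlgHom.comp_id]
  counit_right := hχ.algHom_ext fun i => by
    rw [← AlgHom.comp_assoc, ← AlgHom.comp_assoc, AlgHom.comp_assoc (χ i), comp_rid_comp_map,
      comul, right_unit, AlgHom.comp_id]

end ProductMap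

namespace UAUProduct

open Algebra.TensorProduct

variable {d m : ℕ} (P : UAUProduct.{u} d m) {A : FacedAlg.{u} m} (T : DualSemigroup A)

/-- The convolution `(φ₁ ⊙ φ₂) ∘ Δ` of two tuples of functionals on a dual semigroup. -/
def convolution (φ₁ φ₂ : DualTuple d A) : DualTuple d A :=
  (P.prod A A φ₁ φ₂).comp (A := Coprod A A) T.Δ

/-- The comultiplication `S(σ ∘ Δ)`. -/
def symComul : SymmetricAlgebra ℂ (Fin d → A) →ₐ[ℂ]
    SymmetricAlgebra ℂ (Fin d → A) ⊗[ℂ] SymmetricAlgebra ℂ (Fin d → A) :=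
  SymmetricAlgebra.lift (P.sigma A A ∘ₗ (T.Δ : A →ₗ[ℂ] Coprod A A).compLeft (Fin d))

theorem productMap_char_comp_symComul (φ₁ φ₂ : DualTuple d A) :
    (productMap φ₁.char φ₂.char).comp (P.symComul T) = (P.convolution T φ₁ φ₂).char := by
  refine SymmetricAlgebra.algHom_ext (LinearMap.ext fun x => ?_)
  have total_convolution : (P.convolution T φ₁ φ₂).total x = (P.prod A A φ₁ φ₂).total
      ((T.Δ : A →ₗ[ℂ] Coprod A A).compLeft (Fin d) x) :=
    LinearMap.congr_fun (DualTuple.total_comp _ _) x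
  change productMap φ₁.char φ₂.char (P.symComul T (SymmetricAlgebra.ι ℂ _ x)) =
    (P.convolution T φ₁ φ₂).char (SymmetricAlgebra.ι ℂ _ x)
  rw [DualTuple.char_ι, total_convolution, symComul, SymmetricAlgebra.lift_ι_apply]
  exact P.productMap_char_sigma φ₁ φ₂ _

variable {T}

theorem convolution_assoc (hT : FacedAlg.RespectsFaces A (A.prod A) T.Δ)
    (φ₁ φ₂ φ₃ : DualTuple d A) : P.convolution T (P.convolution T φ₁ φ₂) φ₃ =
      P.convolution T φ₁ (P.convolution T φ₂ φ₃) := by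
  have split_first := P.universal (A.prod A) A A A T.Δ (NonUnitalAlgHom.id ℂ A) hT (.id A)
    (P.prod A A φ₁ φ₂) φ₃
  have split_second := P.universal A (A.prod A) A A (NonUnitalAlgHom.id ℂ A) T.Δ (.id A) hT
    φ₁ (P.prod A A φ₂ φ₃)
  rw [← P.associative A A A φ₁ φ₂ φ₃] at split_second
  funext l
  refine LinearMap.ext fun x => ?_
  refine (LinearMap.congr_fun (congrFun split_first l) (T.Δ x)).symm.trans
    (Eq.trans ?_ (LinearMap.congr_fun (congrFun split_second l) (T.Δ x)))
  exact congrArg (P.prod (A.prod A) A (P.prod A A φ₁ φ₂) φ₃ l)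
    (DFunLike.congr_fun T.coassoc x)

variable (T)

theorem convolution_comp {j₁ j₂ : A →ₙₐ[ℂ] A} (hj₁ : FacedAlg.RespectsFaces A A j₁)
    (hj₂ : FacedAlg.RespectsFaces A A j₂) (φ₁ φ₂ : DualTuple d A) :
    P.convolution T (φ₁.comp j₁) (φ₂.comp j₂) =
      (P.prod A A φ₁ φ₂).comp (A := Coprod A A) ((Coprod.map j₁ j₂).comp T.Δ) :=
  congrArg (fun ψ : DualTuple d (Coprod A A) => ψ.comp T.Δ)
    (P.universal A A A A j₁ j₂ hj₁ hj₂ φ₁ φ₂).symm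

theorem convolution_zero_left (φ : DualTuple d A) : P.convolution T 0 φ = φ := by
  have comp_zero : φ.comp (0 : A →ₙₐ[ℂ] A) = 0 :=
    funext fun l => LinearMap.ext fun _ => map_zero (φ l)
  have h := P.convolution_comp T (.zero A A) (.id A) φ φ
  rw [T.counit_left, comp_zero] at h
  exact h.trans (P.unital_right A A φ φ)

theorem convolution_zero_right (φ : DualTuple d A) : P.convolution T φ 0 = φ := by
  have comp_zero : φ.comp (0 : A →ₙₐ[ℂ] A) = 0 :=
    funext fun l => LinearMap.ext fun _ => map_zero (φ l)
  have h := P.convolution_comp T (.id A) (.zero A A) φ φ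
  rw [T.counit_right, comp_zero] at h
  exact h.trans (P.unital_left A A φ φ)

variable {T}

theorem isBialgebra_symComul (hT : FacedAlg.RespectsFaces A (A.prod A) T.Δ) :
    IsBialgebra (P.symComul T) (SymmetricAlgebra.lift 0) := by
  rw [← DualTuple.total_zero]
  exact isBialgebra_of_isSeparating (DualTuple.isSeparating_char d A) (P.convolution T) 0
    (P.productMap_char_comp_symComul T) (P.convolution_assoc hT) (P.convolution_zero_left T)
    (P.convolution_zero_right T)

end UAUProduct

/-! ## Gradings as eigenspaces of dilations -/

theorem apply_mem_of_mem_iSup {R M N Q ι κ : Type*} [CommSemiring R] [AddCommMonoid M]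
    [AddCommMonoid N] [AddCommMonoid Q] [Module R M] [Module R N] [Module R Q]
    (f : M →ₗ[R] N →ₗ[R] Q) {p : ι → Submodule R M} {q : κ → Submodule R N} {s : Submodule R Q}
    (h : ∀ i j, ∀ x ∈ p i, ∀ y ∈ q j, f x y ∈ s) {x : M} {y : N} (hx : x ∈ ⨆ i, p i)
    (hy : y ∈ ⨆ j, q j) : f x y ∈ s := by
  have map₂_iSup_le : Submodule.map₂ f (⨆ i, p i) (⨆ j, q j) ≤ s := by
    rw [Submodule.map₂_iSup_left]
    refine iSup_le fun i => ?_
    rw [Submodule.map₂_iSup_right]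
    exact iSup_le fun j => Submodule.map₂_le.2 (h i j)
  exact map₂_iSup_le (Submodule.apply_mem_map₂ f hx hy)

theorem linearMap_ext_of_iSup_eq_top {R M N ι : Type*} [Semiring R] [AddCommMonoid M]
    [AddCommMonoid N] [Module R M] [Module R N] {p : ι → Submodule R M} (htop : ⨆ i, p i = ⊤)
    {f g : M →ₗ[R] N} (h : ∀ i, ∀ x ∈ p i, f x = g x) : f = g :=
  LinearMap.eqLocus_eq_top.1 (top_le_iff.1 (htop ▸ iSup_le h))

theorem exists_linearMap_of_isInternal {R M N ι : Type*} [Ring R] [AddCommGroup M]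
    [AddCommGroup N] [Module R M] [Module R N] [DecidableEq ι] {p : ι → Submodule R M}
    (h : DirectSum.IsInternal p) (f : ι → M →ₗ[R] N) :
    ∃ F : M →ₗ[R] N, ∀ i, ∀ x ∈ p i, F x = f i x := by
  let e := LinearEquiv.ofBijective (DirectSum.coeLinearMap p) h
  refine ⟨DirectSum.toModule R ι N (fun i => f i ∘ₗ (p i).subtype) ∘ₗ e.symm.toLinearMap,
    fun i x hx => ?_⟩
  have symm_apply : e.symm x = DirectSum.lof R ι (fun i => p i) i ⟨x, hx⟩ :=
    e.symm_apply_eq.2 (DirectSum.coeLinearMap_lof p i ⟨x, hx⟩).symm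
  simp [symm_apply]

theorem injective_two_pow {R : Type*} [Semiring R] [CharZero R] :
    Function.Injective fun n : ℕ => (2 : R) ^ n := fun n k hnk =>
  Nat.pow_right_injective le_rfl (Nat.cast_injective (R := R) (by simpa using hnk))

section Dilation

variable {K W W' ι : Type*} [Field K] [AddCommGroup W] [Module K W] [AddCommGroup W']
  [Module K W']

/-- The map `θ` is multiplication by `2 ^ deg i` on `𝒲 i`. The components of a grading are thus
eigenspaces of its dilation, which turns homogeneity into commutation with dilations. -/
def IsDilation (deg : ι → ℕ) (𝒲 : ι → Submodule K W) (θ : W → W) : Prop :=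
  ∀ i, ∀ w ∈ 𝒲 i, θ w = (2 : K) ^ deg i • w

namespace IsDilation

variable {deg : ι → ℕ} {𝒲 : ι → Submodule K W} {𝒲' : ι → Submodule K W'} {θ : W →ₗ[K] W}
  {θ' : W' →ₗ[K] W'}

theorem exists_of_isInternal [DecidableEq ι] (h : DirectSum.IsInternal 𝒲) (deg : ι → ℕ) :
    ∃ θ : W →ₗ[K] W, IsDilation deg 𝒲 θ :=
  exists_linearMap_of_isInternal h fun i => (2 : K) ^ deg i • LinearMap.id

theorem map_apply (h : IsDilation deg 𝒲 θ) (h' : IsDilation deg 𝒲' θ') (htop : ⨆ i, 𝒲 i = ⊤)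
    {f : W →ₗ[K] W'} (hf : ∀ i, ∀ w ∈ 𝒲 i, f w ∈ 𝒲' i) (w : W) : f (θ w) = θ' (f w) := by
  have comp_eq : f ∘ₗ θ = θ' ∘ₗ f := linearMap_ext_of_iSup_eq_top htop fun i w hw => by
    rw [LinearMap.comp_apply, LinearMap.comp_apply, h i w hw, map_smul, h' i _ (hf i w hw)]
  exact LinearMap.congr_fun comp_eq w

theorem le_eigenspace (h : IsDilation deg 𝒲 θ) (i : ι) :
    𝒲 i ≤ Module.End.eigenspace θ ((2 : K) ^ deg i) :=
  fun w hw => Module.End.mem_eigenspace_iff.2 (h i w hw)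

variable [CharZero K]

theorem isInternal [DecidableEq ι] (h : IsDilation deg 𝒲 θ) (hdeg : Function.Injective deg)
    (htop : ⨆ i, 𝒲 i = ⊤) : DirectSum.IsInternal 𝒲 :=
  DirectSum.isInternal_submodule_of_iSupIndep_of_iSup_eq_top
    ((Module.End.eigenspaces_iSupIndep θ |>.comp (injective_two_pow.comp hdeg)).mono
      h.le_eigenspace) htop

theorem eq_eigenspace (h : IsDilation deg 𝒲 θ) (hdeg : Function.Injective deg)
    (htop : ⨆ i, 𝒲 i = ⊤) : 𝒲 = fun i => Module.End.eigenspace θ ((2 : K) ^ deg i) :=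
  ((Module.End.eigenspaces_iSupIndep θ |>.comp
    (injective_two_pow.comp hdeg)).le_iff_eq_of_iSup_eq_top htop).1 h.le_eigenspace

theorem map_mem (h : IsDilation deg 𝒲 θ) (h' : IsDilation deg 𝒲' θ')
    (hdeg : Function.Injective deg) (htop' : ⨆ i, 𝒲' i = ⊤) {f : W →ₗ[K] W'}
    (hf : ∀ w, f (θ w) = θ' (f w)) {i : ι} {w : W} (hw : w ∈ 𝒲 i) : f w ∈ 𝒲' i := by
  rw [h'.eq_eigenspace hdeg htop', Module.End.mem_eigenspace_iff, ← hf, h i w hw, map_smul]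

end IsDilation

end Dilation

section Generated

variable {A : Type*} [NonUnitalRing A] [Module ℂ A] {G : ℕ+ → Set A}

theorem mem_generatedGrading {n : ℕ+} {a : A} (h : a ∈ G n) : a ∈ generatedGrading G n :=
  Submodule.subset_span (ProductOfDegree.of h)

theorem generatedGrading_le {s : ℕ+ → Submodule ℂ A} (h : ∀ n, ∀ a ∈ G n, a ∈ s n)
    (hmul : ∀ n k a b, a ∈ s n → b ∈ s k → a * b ∈ s (n + k)) (n : ℕ+) :
    generatedGrading G n ≤ s n := by
  refine Submodule.span_le.2 fun a ha => ?_
  induction ha with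
  | of ha => exact h _ _ ha
  | mul _ _ hx hy => exact hmul _ _ _ _ hx hy

variable [IsScalarTower ℂ A A] [SMulCommClass ℂ A A]

theorem mul_mem_generatedGrading {n k : ℕ+} {a b : A} (ha : a ∈ generatedGrading G n)
    (hb : b ∈ generatedGrading G k) : a * b ∈ generatedGrading G (n + k) := by
  have map₂_le : Submodule.map₂ (LinearMap.mul ℂ A) (generatedGrading G n)
      (generatedGrading G k) ≤ generatedGrading G (n + k) := by
    rw [generatedGrading, generatedGrading, Submodule.map₂_span_span, Submodule.span_le]
    rintro _ ⟨x, hx, y, hy, rfl⟩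
    exact Submodule.subset_span (ProductOfDegree.mul hx hy)
  exact map₂_le (Submodule.apply_mem_map₂ (LinearMap.mul ℂ A) ha hb)

theorem isDilation_generatedGrading (θ : A →ₙₐ[ℂ] A)
    (h : ∀ n, ∀ a ∈ G n, θ a = (2 : ℂ) ^ (n : ℕ) • a) :
    IsDilation PNat.val (generatedGrading G) (θ : A →ₗ[ℂ] A) := by
  refine fun n a ha => Module.End.mem_eigenspace_iff.1
    (generatedGrading_le (s := fun n => Module.End.eigenspace (θ : A →ₗ[ℂ] A) (2 ^ (n : ℕ)))
      (fun n a ha => Module.End.mem_eigenspace_iff.2 (h n a ha)) (fun n k a b ha hb => ?_) n ha)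
  have apply_left : θ a = (2 : ℂ) ^ (n : ℕ) • a := Module.End.mem_eigenspace_iff.1 ha
  have apply_right : θ b = (2 : ℂ) ^ (k : ℕ) • b := Module.End.mem_eigenspace_iff.1 hb
  refine Module.End.mem_eigenspace_iff.2 ((map_mul θ a b).trans ?_)
  rw [apply_left, apply_right, smul_mul_smul_comm, PNat.add_coe, pow_add]

theorem iSup_generatedGrading_eq_top
    (h : ∀ N : NonUnitalSubalgebra ℂ A, (∀ n, ∀ a ∈ G n, a ∈ N) → N = ⊤) :
    ⨆ n, generatedGrading G n = ⊤ := by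
  let N : NonUnitalSubalgebra ℂ A :=
    { (⨆ n, generatedGrading G n : Submodule ℂ A) with
      mul_mem' := fun ha hb => apply_mem_of_mem_iSup (LinearMap.mul ℂ A)
        (fun i j x hx y hy => Submodule.mem_iSup_of_mem (i + j)
          (mul_mem_generatedGrading hx hy)) ha hb }
  have eq_top : N = ⊤ :=
    h N fun n a ha => Submodule.mem_iSup_of_mem n (mem_generatedGrading ha)
  exact Submodule.eq_top_iff'.2 fun a => eq_top.ge NonUnitalAlgebra.mem_top

theorem map_mem_generatedGrading {B : Type*} [NonUnitalRing B] [Module ℂ B] {H : ℕ+ → Set B}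
    (f : B →ₙₐ[ℂ] A) (h : ∀ n, ∀ b ∈ H n, f b ∈ generatedGrading G n) {n : ℕ+} {b : B}
    (hb : b ∈ generatedGrading H n) : f b ∈ generatedGrading G n :=
  generatedGrading_le (s := fun n => (generatedGrading G n).comap (f : B →ₗ[ℂ] A)) h
    (fun n k a b ha hb => by
      change f (a * b) ∈ generatedGrading G (n + k)
      rw [map_mul]
      exact mul_mem_generatedGrading ha hb) n hb

theorem IsGradedAlg.exists_isDilation {𝒜 : ℕ+ → Submodule ℂ A} (h : IsGradedAlg 𝒜) :
    ∃ θ : A →ₙₐ[ℂ] A, IsDilation PNat.val 𝒜 (θ : A →ₗ[ℂ] A) := by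
  obtain ⟨θ, hθ⟩ := IsDilation.exists_of_isInternal h.isInternal PNat.val
  have mem_iSup (a : A) : a ∈ ⨆ n, 𝒜 n := h.isInternal.submodule_iSup_eq_top ▸ Submodule.mem_top
  have map_mul_sub (a b : A) : θ (a * b) - θ a * θ b ∈ (⊥ : Submodule ℂ A) := by
    refine apply_mem_of_mem_iSup
      ((LinearMap.mul ℂ A).compr₂ θ - (LinearMap.mul ℂ A).compl₁₂ θ θ)
      (fun i j x hx y hy => sub_eq_zero.2 ?_) (mem_iSup a) (mem_iSup b)
    change θ (x * y) = θ x * θ y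
    rw [hθ i x hx, hθ j y hy, hθ (i + j) _ (h.mul_mem hx hy), smul_mul_smul_comm,
      ← pow_add]
    rfl
  exact ⟨{ θ with map_zero' := map_zero θ, map_mul' := fun a b => sub_eq_zero.1 (map_mul_sub a b) },
    hθ⟩

end Generated

section SymGrading

/-- The homomorphism `S(f) : S(W) → S(W')` induced by a linear map `f : W → W'`. -/
def symMap {R W W' : Type*} [CommRing R] [AddCommGroup W] [Module R W] [AddCommGroup W']
    [Module R W'] (f : W →ₗ[R] W') : SymmetricAlgebra R W →ₐ[R] SymmetricAlgebra R W' :=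
  SymmetricAlgebra.lift (SymmetricAlgebra.ι R W' ∘ₗ f)

variable {W : Type*} [AddCommGroup W] [Module ℂ W] (𝒲 : ℕ+ → Submodule ℂ W)

theorem one_mem_symGrading : (1 : SymmetricAlgebra ℂ W) ∈ symGrading 𝒲 0 :=
  Submodule.subset_span ⟨0, Fin.elim0, Fin.elim0, fun i => i.elim0, by simp, by simp⟩

variable {𝒲}

theorem ι_mem_symGrading {n : ℕ+} {w : W} (hw : w ∈ 𝒲 n) :
    SymmetricAlgebra.ι ℂ W w ∈ symGrading 𝒲 n :=
  Submodule.subset_span ⟨1, fun _ => n, fun _ => w, fun _ => hw, by simp, by simp⟩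

theorem mul_mem_symGrading {n k : ℕ} {a b : SymmetricAlgebra ℂ W} (ha : a ∈ symGrading 𝒲 n)
    (hb : b ∈ symGrading 𝒲 k) : a * b ∈ symGrading 𝒲 (n + k) := by
  have mul_mem := Submodule.mul_mem_mul ha hb
  rw [symGrading, symGrading, Submodule.span_mul_span] at mul_mem
  refine Submodule.span_mono ?_ mul_mem
  rintro _ ⟨_, ⟨r, e, w, hw, rfl, rfl⟩, _, ⟨s, f, v, hv, rfl, rfl⟩, rfl⟩
  refine ⟨r + s, Fin.append e f, Fin.append w v, fun i => ?_, ?_, ?_⟩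
  · induction i using Fin.addCases with
    | left i => simpa using hw i
    | right i => simpa using hv i
  · simp [Fin.sum_univ_add]
  · simp [Fin.prod_univ_add]

variable (𝒲)

theorem gradedMonoid_symGrading : SetLike.GradedMonoid (symGrading 𝒲) where
  one_mem := one_mem_symGrading 𝒲
  mul_mem _ _ _ _ ha hb := mul_mem_symGrading ha hb

theorem symGrading_zero : symGrading 𝒲 0 = Submodule.span ℂ {1} := by
  refine le_antisymm (Submodule.span_le.2 ?_)
    ((Submodule.span_singleton_le_iff_mem _ _).2 (one_mem_symGrading 𝒲))
  rintro _ ⟨r, e, w, _, sum_eq_zero, rfl⟩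
  have isEmpty_fin : IsEmpty (Fin r) :=
    ⟨fun i => (e i).ne_zero (Finset.sum_eq_zero_iff.1 sum_eq_zero i (Finset.mem_univ i))⟩
  simp

variable {𝒲}

theorem iSup_symGrading_eq_top (htop : ⨆ n, 𝒲 n = ⊤) : ⨆ n, symGrading 𝒲 n = ⊤ := by
  refine Submodule.eq_top_iff'.2 fun x => ?_
  induction x using SymmetricAlgebra.induction with
  | algebraMap r =>
    rw [Algebra.algebraMap_eq_smul_one]
    exact Submodule.smul_mem _ r (Submodule.mem_iSup_of_mem 0 (one_mem_symGrading 𝒲))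
  | ι w =>
    have iSup_le_comap : ⨆ n, 𝒲 n ≤ (⨆ n, symGrading 𝒲 n).comap (SymmetricAlgebra.ι ℂ W) :=
      iSup_le fun n w hw => Submodule.mem_iSup_of_mem (n : ℕ) (ι_mem_symGrading hw)
    exact iSup_le_comap (htop ▸ Submodule.mem_top)
  | mul a b ha hb =>
    exact apply_mem_of_mem_iSup (LinearMap.mul ℂ (SymmetricAlgebra ℂ W))
      (fun i j x hx y hy => Submodule.mem_iSup_of_mem (i + j) (mul_mem_symGrading hx hy)) ha hb
  | add a b ha hb => exact add_mem ha hb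

theorem isDilation_symMap {θ : W →ₗ[ℂ] W} (h : IsDilation PNat.val 𝒲 θ) :
    IsDilation id (symGrading 𝒲) (symMap θ).toLinearMap := by
  refine fun n x hx => Module.End.mem_eigenspace_iff.1 (Submodule.span_le.2 ?_ hx)
  rintro _ ⟨r, e, w, hw, rfl, rfl⟩
  refine Module.End.mem_eigenspace_iff.2 ?_
  rw [AlgHom.toLinearMap_apply, map_prod, id, ← Finset.prod_pow_eq_pow_sum, ← Finset.prod_smul]
  refine Finset.prod_congr rfl fun i _ => ?_
  rw [symMap, SymmetricAlgebra.lift_ι_apply, LinearMap.comp_apply, h _ _ (hw i), map_smul]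

theorem lift_zero_of_mem_symGrading {n : ℕ} (hn : n ≠ 0) {x : SymmetricAlgebra ℂ W}
    (hx : x ∈ symGrading 𝒲 n) : SymmetricAlgebra.lift (0 : W →ₗ[ℂ] ℂ) x = 0 := by
  have span_le_ker : symGrading 𝒲 n ≤
      LinearMap.ker (SymmetricAlgebra.lift (0 : W →ₗ[ℂ] ℂ)).toLinearMap := by
    refine Submodule.span_le.2 ?_
    rintro _ ⟨r, e, w, hw, rfl, rfl⟩
    have pos : 0 < r := Nat.pos_of_ne_zero (by rintro rfl; simp at hn)
    rw [SetLike.mem_coe, LinearMap.mem_ker, AlgHom.toLinearMap_apply, map_prod]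
    exact Finset.prod_eq_zero (Finset.mem_univ ⟨0, pos⟩) (by simp)
  exact span_le_ker hx

end SymGrading

section TensorDegree

variable {B : Type*} [CommRing B] [Algebra ℂ B] {ℬ : ℕ → Submodule ℂ B}

theorem tmul_mem_tensorDegree {k l : ℕ} {b c : B} (hb : b ∈ ℬ k) (hc : c ∈ ℬ l) :
    b ⊗ₜ c ∈ tensorDegree ℬ (k + l) :=
  Submodule.mem_iSup_of_mem (k, l) (Submodule.mem_iSup_of_mem
    (Finset.HasAntidiagonal.mem_antidiagonal.2 rfl) ⟨⟨b, hb⟩ ⊗ₜ ⟨c, hc⟩, rfl⟩)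

theorem tensorDegree_le {n : ℕ} {N : Submodule ℂ (B ⊗[ℂ] B)}
    (h : ∀ k l, k + l = n → ∀ b ∈ ℬ k, ∀ c ∈ ℬ l, b ⊗ₜ c ∈ N) : tensorDegree ℬ n ≤ N := by
  refine iSup₂_le fun p hp => ?_
  rintro _ ⟨t, rfl⟩
  induction t using TensorProduct.induction_on with
  | zero => simp
  | tmul b c => exact h p.1 p.2 (Finset.HasAntidiagonal.mem_antidiagonal.1 hp) b b.2 c c.2
  | add x y hx hy => rw [map_add]; exact add_mem hx hy

theorem iSup_tensorDegree_eq_top (htop : ⨆ n, ℬ n = ⊤) : ⨆ n, tensorDegree ℬ n = ⊤ := by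
  refine Submodule.eq_top_iff'.2 fun t => ?_
  induction t using TensorProduct.induction_on with
  | zero => exact zero_mem _
  | tmul b c =>
    exact apply_mem_of_mem_iSup (TensorProduct.mk ℂ B B)
      (fun k l x hx y hy => Submodule.mem_iSup_of_mem (k + l) (tmul_mem_tensorDegree hx hy))
      (htop ▸ Submodule.mem_top : b ∈ ⨆ n, ℬ n) (htop ▸ Submodule.mem_top : c ∈ ⨆ n, ℬ n)
  | add x y hx hy => exact add_mem hx hy

theorem isDilation_tensorMap {Θ : B →ₗ[ℂ] B} (h : IsDilation id ℬ Θ) :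
    IsDilation id (tensorDegree ℬ) (TensorProduct.map Θ Θ) := by
  refine fun n t ht => Module.End.mem_eigenspace_iff.1
    (tensorDegree_le (fun k l hkl b hb c hc => Module.End.mem_eigenspace_iff.2 ?_) ht)
  rw [TensorProduct.map_tmul, h k b hb, h l c hc, TensorProduct.smul_tmul_smul, ← pow_add,
    ← hkl]
  rfl

end TensorDegree

section Pi

variable {K W κ ι : Type*} [Field K] [AddCommGroup W] [Module K W] {𝒲 : ι → Submodule K W}

theorem isDilation_compLeft {deg : ι → ℕ} {θ : W →ₗ[K] W} (h : IsDilation deg 𝒲 θ) :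
    IsDilation deg (fun i => Submodule.pi Set.univ fun _ : κ => 𝒲 i) (θ.compLeft κ) :=
  fun i w hw => funext fun l => h i (w l) (hw l trivial)

theorem iSup_pi_eq_top [Finite κ] (htop : ⨆ i, 𝒲 i = ⊤) :
    ⨆ i, (Submodule.pi Set.univ fun _ : κ => 𝒲 i : Submodule K (κ → W)) = ⊤ := by
  classical
  have := Fintype.ofFinite κ
  have iSup_le_comap (l : κ) : ⨆ i, 𝒲 i ≤ (⨆ i, (Submodule.pi Set.univ fun _ : κ => 𝒲 i :
      Submodule K (κ → W))).comap (LinearMap.single K (fun _ => W) l) :=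
    iSup_le fun i w hw => Submodule.mem_iSup_of_mem i fun k _ => by
      rcases eq_or_ne k l with rfl | hkl
      · simpa using hw
      · simp [hkl]
  refine Submodule.eq_top_iff'.2 fun x => ?_
  rw [← Finset.univ_sum_single x]
  exact sum_mem fun l _ => iSup_le_comap l (htop ▸ Submodule.mem_top)

end Pi

/-! ## The grading of the bialgebra -/

theorem DualTuple.char_comp_symMap {d : ℕ} {A : Type*} [NonUnitalRing A]
    [Module ℂ A] (φ : DualTuple d A) (θ : A →ₙₐ[ℂ] A) :
    φ.char.comp (symMap ((θ : A →ₗ[ℂ] A).compLeft (Fin d))) = (φ.comp θ).char := by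
  refine SymmetricAlgebra.algHom_ext (LinearMap.ext fun x => ?_)
  change φ.char (symMap _ (SymmetricAlgebra.ι ℂ _ x)) = (φ.comp θ).char (SymmetricAlgebra.ι ℂ _ x)
  rw [symMap, SymmetricAlgebra.lift_ι_apply, LinearMap.comp_apply, DualTuple.char_ι,
    DualTuple.char_ι, DualTuple.total_comp, LinearMap.comp_apply]

namespace UAUProduct

open Algebra.TensorProduct

variable {d m : ℕ} (P : UAUProduct.{u} d m) {A : FacedAlg.{u} m} {T : DualSemigroup A}
  {θ : A →ₙₐ[ℂ] A}

theorem map_symMap_comp_symComul (hθ : FacedAlg.RespectsFaces A A θ)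
    (hΔ : (Coprod.map θ θ).comp T.Δ = T.Δ.comp θ) :
    (map (symMap ((θ : A →ₗ[ℂ] A).compLeft (Fin d)))
        (symMap ((θ : A →ₗ[ℂ] A).compLeft (Fin d)))).comp (P.symComul T) =
      (P.symComul T).comp (symMap ((θ : A →ₗ[ℂ] A).compLeft (Fin d))) := by
  have separating := DualTuple.isSeparating_char d A
  refine (separating.tensor separating).algHom_ext fun φ => ?_
  rw [← AlgHom.comp_assoc, ← AlgHom.comp_assoc, productMap_comp_map, DualTuple.char_comp_symMap,
    DualTuple.char_comp_symMap, productMap_char_comp_symComul, productMap_char_comp_symComul,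
    DualTuple.char_comp_symMap, P.convolution_comp T hθ hθ, hΔ]
  rfl

theorem isGradedBialgebra_symComul (hT : FacedAlg.RespectsFaces A (A.prod A) T.Δ)
    {𝒜 : ℕ+ → Submodule ℂ A} (htop : ⨆ n, 𝒜 n = ⊤)
    (hθ : IsDilation PNat.val 𝒜 (θ : A →ₗ[ℂ] A)) (hface : FacedAlg.RespectsFaces A A θ)
    (hΔ : (Coprod.map θ θ).comp T.Δ = T.Δ.comp θ) :
    IsGradedBialgebra (symGrading fun n => Submodule.pi Set.univ fun _ : Fin d => 𝒜 n)
      (P.symComul T) (SymmetricAlgebra.lift 0) := by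
  have dilation := isDilation_symMap (isDilation_compLeft (κ := Fin d) hθ)
  have iSup_eq_top := iSup_symGrading_eq_top (iSup_pi_eq_top (κ := Fin d) htop)
  exact
    { isBialgebra := P.isBialgebra_symComul hT
      isInternal := dilation.isInternal Function.injective_id iSup_eq_top
      gradedMonoid := gradedMonoid_symGrading _
      comul_mem := fun n b hb => dilation.map_mem (f := (P.symComul T).toLinearMap)
        (isDilation_tensorMap dilation) Function.injective_id
        (iSup_tensorDegree_eq_top iSup_eq_top)
        (fun x => (DFunLike.congr_fun (P.map_symMap_comp_symComul hface hΔ) x).symm) hb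
      counit_eq_zero := fun n hn b hb => lift_zero_of_mem_symGrading hn hb }

end UAUProduct

section PowerMap

open FacedAlg

variable {m : ℕ} {D : Type u} [NonUnitalRing D] [Module ℂ D] [IsScalarTower ℂ D D]
  [SMulCommClass ℂ D D] {S : DualSemigroup D} {𝒟 : ℕ+ → Submodule ℂ D} {θ : D →ₙₐ[ℂ] D}

/-- The endomorphism `θ^{⊔ m}` of `D^{⊔ m}`. -/
def powerMap (m : ℕ) (θ : D →ₙₐ[ℂ] D) : FacedAlg.power m D →ₙₐ[ℂ] FacedAlg.power m D :=
  FreeProd.lift (A := fun _ : Fin m => D) fun k => (powerι k).comp θ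

theorem powerMap_comp_powerι (θ : D →ₙₐ[ℂ] D) (k : Fin m) :
    (powerMap m θ).comp (powerι k) = (powerι k).comp θ :=
  NonUnitalAlgHom.ext (FreeProd.lift_ι (A := fun _ : Fin m => D) _ k)

theorem powerMap_powerι (θ : D →ₙₐ[ℂ] D) (k : Fin m) (a : D) :
    powerMap m θ (powerι k a) = powerι k (θ a) :=
  DFunLike.congr_fun (powerMap_comp_powerι θ k) a

theorem respectsFaces_powerMap (θ : D →ₙₐ[ℂ] D) :
    RespectsFaces (FacedAlg.power m D) (FacedAlg.power m D) (powerMap m θ) := by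
  rintro k _ ⟨a, rfl⟩
  exact ⟨θ a, (powerMap_powerι θ k a).symm⟩

theorem isDilation_powerMap (h : IsDilation PNat.val 𝒟 (θ : D →ₗ[ℂ] D)) :
    IsDilation PNat.val (powerGrading m 𝒟)
      (powerMap m θ : FacedAlg.power m D →ₗ[ℂ] FacedAlg.power m D) := by
  refine isDilation_generatedGrading (A := FacedAlg.power m D) (powerMap m θ) ?_
  rintro n _ ⟨k, a, ha, rfl⟩
  have apply_eq : θ a = (2 : ℂ) ^ (n : ℕ) • a := h n a ha
  refine (powerMap_powerι θ k a).trans ?_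
  rw [apply_eq]
  exact map_smul (powerι k) _ a

theorem iSup_powerGrading_eq_top (htop : ⨆ n, 𝒟 n = ⊤) : ⨆ n, powerGrading m 𝒟 n = ⊤ := by
  refine iSup_generatedGrading_eq_top (A := FreeProd fun _ : Fin m => D) fun N hN =>
    FreeProd.eq_top_of_ι_mem fun k a => ?_
  have iSup_le_comap : ⨆ n, 𝒟 n ≤ N.toSubmodule.comap
      (FreeProd.ι (A := fun _ : Fin m => D) k : D →ₗ[ℂ] FreeProd fun _ : Fin m => D) :=
    iSup_le fun n a ha => hN n _ ⟨k, a, ha, rfl⟩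
  exact iSup_le_comap (htop ▸ Submodule.mem_top)

theorem DualSemigroup.IsGraded.map_comp_Δ (hS : S.IsGraded 𝒟)
    (hθ : IsDilation PNat.val 𝒟 (θ : D →ₗ[ℂ] D)) :
    (Coprod.map θ θ).comp S.Δ = S.Δ.comp θ := by
  have dilation : IsDilation PNat.val (coprodGrading 𝒟)
      (Coprod.map θ θ : Coprod D D →ₗ[ℂ] Coprod D D) := by
    refine isDilation_generatedGrading (Coprod.map θ θ) ?_
    rintro n _ (⟨a, ha, rfl⟩ | ⟨a, ha, rfl⟩)
    · exact (Coprod.map_inl θ θ a).trans ((congrArg _ (hθ n a ha)).trans (map_smul _ _ a))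
    · exact (Coprod.map_inr θ θ a).trans ((congrArg _ (hθ n a ha)).trans (map_smul _ _ a))
  exact NonUnitalAlgHom.ext fun a =>
    (hθ.map_apply dilation hS.isGradedAlg.isInternal.submodule_iSup_eq_top
      (f := (S.Δ : D →ₗ[ℂ] Coprod D D)) hS.comul_mem a).symm

theorem map_powerMap_comp_powerComul (h : (Coprod.map θ θ).comp S.Δ = S.Δ.comp θ) :
    (Coprod.map (powerMap m θ) (powerMap m θ)).comp (S.powerComul m) =
      (S.powerComul m).comp (powerMap m θ) := by
  refine power_hom_ext fun k => NonUnitalAlgHom.ext fun a => ?_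
  have comul_apply : Coprod.map θ θ (S.Δ a) = S.Δ (θ a) := DFunLike.congr_fun h a
  simp only [NonUnitalAlgHom.comp_apply]
  rw [powerMap_powerι, S.powerComul_powerι, S.powerComul_powerι, Coprod.map_map,
    powerMap_comp_powerι, ← Coprod.map_map, comul_apply]

theorem isGradedBialgebra_lachs {d : ℕ} (P : UAUProduct.{u} d m) (hS : S.IsGraded 𝒟) :
    IsGradedBialgebra (lachsGrading d m 𝒟) (lachsComul P S) (lachsCounit d m D) := by
  obtain ⟨θ, hθ⟩ := hS.isGradedAlg.exists_isDilation
  exact P.isGradedBialgebra_symComul (T := S.power m) (S.respectsFaces_powerΔ m)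
    (iSup_powerGrading_eq_top hS.isGradedAlg.isInternal.submodule_iSup_eq_top)
    (isDilation_powerMap hθ) (respectsFaces_powerMap θ)
    (map_powerMap_comp_powerComul (hS.map_comp_Δ hθ))

end PowerMap

section Tensor

variable {V : Type u} [AddCommGroup V] [Module ℂ V]

namespace NTensor

theorem eq_top_of_ι_mem {N : NonUnitalSubalgebra ℂ (NTensor V)} (h : ∀ v, ι v ∈ N) : N = ⊤ := by
  refine NonUnitalAlgebra.eq_top_iff.2 fun ⟨x, hx⟩ => ?_
  induction hx using NonUnitalAlgebra.adjoin_induction with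
  | mem x hx => obtain ⟨v, rfl⟩ := hx; exact h v
  | add x y hx hy ihx ihy => exact N.add_mem ihx ihy
  | zero => exact N.zero_mem
  | mul x y hx hy ihx ihy => exact N.mul_mem ihx ihy
  | smul r x hx ih => exact N.smul_mem r ih

variable {𝒱 : ℕ+ → Submodule ℂ V}

theorem isGradedAlg_grading (h : DirectSum.IsInternal 𝒱) : IsGradedAlg (grading 𝒱) := by
  obtain ⟨θ, hθ⟩ := IsDilation.exists_of_isInternal h PNat.val
  have dilation : IsDilation PNat.val (grading 𝒱)
      (lift (ι ∘ₗ θ) : NTensor V →ₗ[ℂ] NTensor V) := by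
    refine isDilation_generatedGrading _ ?_
    rintro n _ ⟨v, hv, rfl⟩
    rw [lift_ι, LinearMap.comp_apply, hθ n v hv, map_smul]
  have iSup_eq_top : ⨆ n, grading 𝒱 n = ⊤ :=
    iSup_generatedGrading_eq_top fun N hN => eq_top_of_ι_mem fun v => by
      have iSup_le_comap : ⨆ n, 𝒱 n ≤ N.toSubmodule.comap ι :=
        iSup_le fun n v hv => hN n _ ⟨v, hv, rfl⟩
      exact iSup_le_comap (h.submodule_iSup_eq_top ▸ Submodule.mem_top)
  exact ⟨dilation.isInternal PNat.coe_injective iSup_eq_top, mul_mem_generatedGrading⟩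

theorem isGraded_dualSemigroup (h : DirectSum.IsInternal 𝒱) :
    (dualSemigroup V).IsGraded (grading 𝒱) := by
  refine ⟨isGradedAlg_grading h, fun n a ha => map_mem_generatedGrading _ ?_ ha⟩
  rintro n _ ⟨v, hv, rfl⟩
  have ι_mem : ι v ∈ grading 𝒱 n := mem_generatedGrading ⟨v, hv, rfl⟩
  change comul V (ι v) ∈ _
  rw [comul_ι]
  exact add_mem (mem_generatedGrading (Or.inl ⟨_, ι_mem, rfl⟩))
    (mem_generatedGrading (Or.inr ⟨_, ι_mem, rfl⟩))

end NTensor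

end Tensor

/-! ## The antipode of a connected graded bialgebra -/

section ConvolutionInverse

open Coalgebra WithConv

variable {B A : Type*} [CommRing B] [Algebra ℂ B] [Coalgebra ℂ B] [Ring A] [Algebra ℂ A]
  {ℬ : ℕ → Submodule ℂ B}

theorem convMul_apply_mem {f g : WithConv (B →ₗ[ℂ] A)} {n : ℕ} {N : Submodule ℂ A}
    (h : ∀ k l, k + l = n → ∀ b ∈ ℬ k, ∀ c ∈ ℬ l, f.ofConv b * g.ofConv c ∈ N) {b : B}
    (hb : comul (R := ℂ) b ∈ tensorDegree ℬ n) : (f * g).ofConv b ∈ N :=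
  tensorDegree_le (N := N.comap (LinearMap.mul' ℂ A ∘ₗ TensorProduct.map f.ofConv g.ofConv))
    (fun k l hkl b hb c hc => h k l hkl b hb c hc) hb

theorem convMul_apply_congr {f f' g g' : WithConv (B →ₗ[ℂ] A)} {n : ℕ}
    (hf : ∀ k ≤ n, ∀ b ∈ ℬ k, f.ofConv b = f'.ofConv b)
    (hg : ∀ k ≤ n, ∀ b ∈ ℬ k, g.ofConv b = g'.ofConv b) {b : B}
    (hb : comul (R := ℂ) b ∈ tensorDegree ℬ n) : (f * g).ofConv b = (f' * g').ofConv b := by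
  have le_eqLocus : tensorDegree ℬ n ≤ LinearMap.eqLocus
      (LinearMap.mul' ℂ A ∘ₗ TensorProduct.map f.ofConv g.ofConv)
      (LinearMap.mul' ℂ A ∘ₗ TensorProduct.map f'.ofConv g'.ofConv) :=
    tensorDegree_le fun k l hkl b hb c hc =>
      congrArg₂ (· * ·) (hf k (by omega) b hb) (hg l (by omega) c hc)
  exact le_eqLocus hb

theorem convOne_apply_mem {𝒜 : ℕ → Submodule ℂ A} [SetLike.GradedOne 𝒜]
    (counit_eq_zero : ∀ n, n ≠ 0 → ∀ b ∈ ℬ n, counit (R := ℂ) b = 0) (n : ℕ) :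
    ∀ b ∈ ℬ n, (1 : WithConv (B →ₗ[ℂ] A)).ofConv b ∈ 𝒜 n := by
  intro b hb
  change algebraMap ℂ A (counit b) ∈ 𝒜 n
  rcases eq_or_ne n 0 with rfl | hn
  · exact SetLike.algebraMap_mem_graded 𝒜 _
  · rw [counit_eq_zero n hn b hb, map_zero]
    exact zero_mem _

theorem convPow_apply_mem {𝒜 : ℕ → Submodule ℂ A} [SetLike.GradedMonoid 𝒜]
    (comul_mem : ∀ n, ∀ b ∈ ℬ n, comul (R := ℂ) b ∈ tensorDegree ℬ n)
    (counit_eq_zero : ∀ n, n ≠ 0 → ∀ b ∈ ℬ n, counit (R := ℂ) b = 0)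
    {f : WithConv (B →ₗ[ℂ] A)} (hf : ∀ n, ∀ b ∈ ℬ n, f.ofConv b ∈ 𝒜 n) (k : ℕ) :
    ∀ n, ∀ b ∈ ℬ n, (f ^ k).ofConv b ∈ 𝒜 n := by
  induction k with
  | zero => exact convOne_apply_mem counit_eq_zero
  | succ k ih =>
    intro n b hb
    rw [pow_succ]
    refine convMul_apply_mem (fun i j hij a ha c hc => ?_) (comul_mem n b hb)
    exact hij ▸ SetLike.mul_mem_graded (ih i a ha) (hf j c hc)

theorem convPow_apply_eq_zero
    (comul_mem : ∀ n, ∀ b ∈ ℬ n, comul (R := ℂ) b ∈ tensorDegree ℬ n)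
    {f : WithConv (B →ₗ[ℂ] A)} (hf : ∀ b ∈ ℬ 0, f.ofConv b = 0) (k : ℕ) :
    ∀ n < k, ∀ b ∈ ℬ n, (f ^ k).ofConv b = 0 := by
  induction k with
  | zero => intro n hn; omega
  | succ k ih =>
    intro n hn b hb
    rw [pow_succ, ← Submodule.mem_bot ℂ]
    refine convMul_apply_mem (fun i j hij a ha c hc => (Submodule.mem_bot ℂ).2 ?_)
      (comul_mem n b hb)
    rcases eq_or_ne j 0 with rfl | hj
    · rw [hf c hc, mul_zero]
    · rw [ih i (by omega) a ha, zero_mul]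

theorem exists_convInverse (hℬ : DirectSum.IsInternal ℬ)
    (comul_mem : ∀ n, ∀ b ∈ ℬ n, comul (R := ℂ) b ∈ tensorDegree ℬ n)
    {f : WithConv (B →ₗ[ℂ] A)} (hf : ∀ b ∈ ℬ 0, (1 - f).ofConv b = 0) :
    ∃ g : WithConv (B →ₗ[ℂ] A), g * f = 1 ∧ f * g = 1 ∧
      ∀ n, ∀ b ∈ ℬ n, g.ofConv b = ∑ k ∈ Finset.range (n + 1), ((1 - f) ^ k).ofConv b := by
  have pow_apply_eq_zero := convPow_apply_eq_zero comul_mem hf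
  obtain ⟨g, hg⟩ := exists_linearMap_of_isInternal hℬ fun n =>
    ∑ k ∈ Finset.range (n + 1), ((1 - f) ^ k).ofConv
  have apply_eq_geom_sum (n : ℕ) : ∀ k ≤ n, ∀ b ∈ ℬ k,
      g b = (∑ i ∈ Finset.range (n + 1), (1 - f) ^ i).ofConv b := fun k hk b hb => by
    rw [hg k b hb, ofConv_sum, LinearMap.sum_apply, LinearMap.sum_apply]
    exact Finset.sum_subset (Finset.range_mono (by omega)) fun i _ hi =>
      pow_apply_eq_zero i k (by simpa using hi) b hb
  have one_sub_pow_apply (n : ℕ) (b : B) (hb : b ∈ ℬ n) :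
      (1 - (1 - f) ^ (n + 1)).ofConv b = (1 : WithConv (B →ₗ[ℂ] A)).ofConv b := by
    rw [ofConv_sub, LinearMap.sub_apply, pow_apply_eq_zero _ n n.lt_succ_self b hb, sub_zero]
  have ext {f g : WithConv (B →ₗ[ℂ] A)} (h : ∀ n, ∀ b ∈ ℬ n, f.ofConv b = g.ofConv b) : f = g :=
    ofConv_injective (linearMap_ext_of_iSup_eq_top hℬ.submodule_iSup_eq_top h)
  refine ⟨toConv g, ext fun n b hb => ?_, ext fun n b hb => ?_, fun n b hb => ?_⟩
  · rw [convMul_apply_congr (apply_eq_geom_sum n) (fun _ _ _ _ => rfl) (comul_mem n b hb),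
      ← one_sub_pow_apply n b hb, ← geom_sum_mul_neg, sub_sub_cancel]
  · rw [convMul_apply_congr (fun _ _ _ _ => rfl) (apply_eq_geom_sum n) (comul_mem n b hb),
      ← one_sub_pow_apply n b hb, ← mul_neg_geom_sum, sub_sub_cancel]
  · exact (hg n b hb).trans (LinearMap.sum_apply _ _ _)

end ConvolutionInverse

section Antipode

open Coalgebra WithConv

variable {B : Type*} [CommRing B] [Algebra ℂ B] {ℬ : ℕ → Submodule ℂ B}
  {Δ : B →ₐ[ℂ] B ⊗[ℂ] B} {ε : B →ₐ[ℂ] ℂ}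

/-- The bundled bialgebra with comultiplication `Δ` and counit `ε`, giving access to the convolution
product on linear maps. -/
abbrev IsBialgebra.toBialgebra (h : IsBialgebra Δ ε) : Bialgebra ℂ B :=
  Bialgebra.ofAlgHom Δ ε h.coassoc
    (AlgHom.ext fun b => (AlgEquiv.eq_symm_apply _).2 (DFunLike.congr_fun h.counit_left b))
    (AlgHom.ext fun b => (AlgEquiv.eq_symm_apply _).2 (DFunLike.congr_fun h.counit_right b))

theorem IsGradedBialgebra.isGradedHopfAlgebra (h : IsGradedBialgebra ℬ Δ ε)
    (degree_zero : ℬ 0 = Submodule.span ℂ {1}) : IsGradedHopfAlgebra ℬ Δ ε := by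
  let _ : Bialgebra ℂ B := h.isBialgebra.toBialgebra
  have : SetLike.GradedMonoid ℬ := h.gradedMonoid
  have one_sub_id_apply_zero : ∀ b ∈ ℬ 0,
      (1 - toConv LinearMap.id : WithConv (B →ₗ[ℂ] B)).ofConv b = 0 := fun b hb => by
    obtain ⟨r, rfl⟩ := Submodule.mem_span_singleton.1 (degree_zero ▸ hb)
    rw [map_smul, ofConv_sub, LinearMap.sub_apply, LinearMap.convOne_apply, ofConv_toConv,
      LinearMap.id_apply, Bialgebra.counit_one, map_one, sub_self, smul_zero]
  obtain ⟨α, α_mul_id, id_mul_α, α_apply⟩ :=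
    exists_convInverse h.isInternal h.comul_mem one_sub_id_apply_zero
  refine ⟨h, α.ofConv, congrArg ofConv α_mul_id, congrArg ofConv id_mul_α, fun n b hb => ?_⟩
  rw [α_apply n b hb]
  exact sum_mem fun k _ => convPow_apply_mem h.comul_mem h.counit_eq_zero
    (fun n b hb => sub_mem (convOne_apply_mem h.counit_eq_zero n b hb) hb) k n b hb

end Antipode

end

theorem mainTheorem5 {d m : ℕ} (P : UAUProduct.{u} d m) :
    (∀ (D : Type u) [NonUnitalRing D] [Module ℂ D] [IsScalarTower ℂ D D] [SMulCommClass ℂ D D]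
      (S : DualSemigroup D) (𝒟 : ℕ+ → Submodule ℂ D), S.IsGraded 𝒟 →
      (∃! σ, P.IsSigma (FacedAlg.power m D) (FacedAlg.power m D) σ) ∧
      IsGradedBialgebra (lachsGrading d m 𝒟) (lachsComul P S) (lachsCounit d m D)) ∧
    (∀ (V : Type u) [AddCommGroup V] [Module ℂ V] (𝒱 : ℕ+ → Submodule ℂ V),
      DirectSum.IsInternal 𝒱 →
      (NTensor.dualSemigroup V).IsGraded (NTensor.grading 𝒱) ∧
      IsGradedHopfAlgebra (lachsGrading d m (NTensor.grading 𝒱))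
        (lachsComul P (NTensor.dualSemigroup V)) (lachsCounit d m (NTensor V)) ∧
      lachsGrading d m (NTensor.grading 𝒱) 0 = Submodule.span ℂ {1}) := by
  refine ⟨fun D _ _ _ _ S 𝒟 hS => ⟨P.existsUnique_isSigma _ _, isGradedBialgebra_lachs P hS⟩,
    fun V _ _ 𝒱 h𝒱 => ?_⟩
  have graded := NTensor.isGraded_dualSemigroup h𝒱
  have degree_zero : lachsGrading d m (NTensor.grading 𝒱) 0 = Submodule.span ℂ {1} :=
    symGrading_zero _
  exact ⟨graded, (isGradedBialgebra_lachs P graded).isGradedHopfAlgebra degree_zero, degree_zero⟩
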